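/- Notation. For a contraction $S$ on a complex Hilbert space, $D_S=(I-S^*S)^{1/2}$ and $\mathcal D_S=\overline{\operatorname{ran}}\,D_S$. For a Hilbert space $\mathcal F$, $H^2(\mathcal F)$ is the $\mathcal F$-valued Hardy space of the unit disk (analytic functions with norm-square summable Taylor coefficients), $M_\varphi$ is multiplication by $\varphi$, and vectors of $\mathcal F$ are regarded as constant functions in $H^2(\mathcal F)$. A factorization $S=AB$ into contractions is called regular if $\{D_AB h\oplus D_Bh: h\}$ is dense in $\mathcal D_A\oplus\mathcal D_B$. Andô tuples. Let $(T_1,T_2)$ be commuting contractions on a complex Hilbert space $\mathcal H$ and $T=T_1T_2$. An Andô tuple $(\mathcal F,\Lambda,P,U)$ for $(T_1,T_2)$ consists of $\mathcal F=\mathcal D_{T_1}\oplus(\mathcal D_{T_2}\oplus E)$ for a Hilbert space $E$, the isometry $\Lambda:\mathcal D_T\to\mathcal F$ with $\Lambda D_Th=D_{T_1}T_2h\oplus D_{T_2}h\oplus 0$, the orthogonal projection $P$ of $\mathcal F$ onto $\mathcal D_{T_1}$, and a unitary $U$ on $\mathcal F$ with $U(D_{T_1}T_2h\oplus D_{T_2}h\oplus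 0)=D_{T_1}h\oplus D_{T_2}T_1h\oplus 0$ for all $h\in\mathcal H$; here $E=\{0\}$ unless there is no such unitary on $\mathcal D_{T_1}\oplus\mathcal D_{T_2}$ itself. Schäffer-type dilation. Given an Andô tuple $(\mathcal F,\Lambda,P,U)$ for $(T_1,T_2)$, put $E_1=P^\perp U$, $E_2=U^*P$, and on $\mathcal H\oplus H^2(\mathcal F)$ $$V_1=\begin{pmatrix}T_1&0\\E_2^*\Lambda D_T&M_{E_1+zE_2^*}\end{pmatrix},\qquad V_2=\begin{pmatrix}T_2&0\\E_1^*\Lambda D_T&M_{E_2+zE_1^*}\end{pmatrix},\qquad \Pi h=h\oplus 0 .$$ Douglas-type dilation. Let $(\mathcal F_*,\Gamma,P',U')$ be an Andô tuple for $(T_1^*,T_2^*)$, so that $\Gamma D_{T^*}h=D_{T_1^*}T_2^*h\oplus D_{T_2^*}h\oplus 0$, and put $H_1=P'^\perp U'$, $H_2=U'^*P'$. Let $Q\ge 0$ with $Q^2=\lim_n T^nT^{*n}$ (strong limit), and let $X_1^*,X_2^*$ be the commuting isometries on $\overline{\operatorname{ran}}\,Q$ with $X_i^*Q=QT_i^*$.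 Let $W_1,W_2$ be commuting unitaries on a Hilbert space $\mathcal R\supseteq\overline{\operatorname{ran}}\,Q$ such that $W_i^*$ extends $X_i^*$ and $(W_1W_2)^*$ is the minimal unitary extension of $X_1^*X_2^*$. On $H^2(\mathcal F_*)\oplus\mathcal R$ put $$V^D_1=M_{H_1^*+zH_2}\oplus W_1,\qquad V^D_2=M_{H_2^*+zH_1}\oplus W_2,\qquad \tilde\Pi h=\Big(\sum_{n\ge 0}z^n\,\Gamma D_{T^*}T^{*n}h\Big)\oplus Qh .$$ Statement. Let $(T_1,T_2)$ be commuting contractions on a complex Hilbert space $\mathcal H$ and $T=T_1T_2$. Unitaries $W_1,W_2$ as above exist, and if both factorizations $T=T_1T_2$ and $T^*=T_1^*T_2^*$ are regular, then Andô tuples for $(T_1,T_2)$ and for $(T_1^*,T_2^*)$ with $E=\{0\}$ exist. Moreover, for all choices made in the two constructions: 1. $\Lambda:\mathcal D_T\to\mathcal F$ and $\Gamma:\mathcal D_{T^*}\to\mathcal F_*$ are both surjective if and only if both factorizations $T=T_1T_2$ and $T^*=T_1^*T_2^*$ are regular. 2. If $\Lambda$ and $\Gamma$ are surjective (equivalently,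 if both factorizations are regular), then the dilations $(\Pi,V_1,V_2)$ and $(\tilde\Pi,V_1^D,V_2^D)$ of $(T_1,T_2)$ are unitarily equivalent: there is a unitary $\tau:\mathcal H\oplus H^2(\mathcal F)\to H^2(\mathcal F_*)\oplus\mathcal R$ with $\tau V_1=V_1^D\tau$, $\tau V_2=V_2^D\tau$ and $\tau\Pi=\tilde\Pi$. -/

import Mathlib

open ContinuousLinearMap Filter Topology

namespace AndoDilation

noncomputable section

set_option linter.unusedSectionVars false

/-! ### Defect operators -/

section Defect

variable {H : Type*} [NormedAddCommGroup H] [InnerProductSpace ℂ H] [CompleteSpace H]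

/-- The closure of the range of a bounded operator. -/
abbrev closureRange (A : H →L[ℂ] H) : Submodule ℂ H :=
  (LinearMap.range (A : H →ₗ[ℂ] H)).topologicalClosure

/-- A bounded operator `A`, viewed as a map into the closure of its range. -/
def toClosureRange (A : H →L[ℂ] H) : H →L[ℂ] closureRange A :=
  A.codRestrict _ fun h => Submodule.le_topologicalClosure _ ⟨h, rfl⟩

@[simp] lemma coe_toClosureRange (A : H →L[ℂ] H) (h : H) :
    (toClosureRange A h : H) = A h := rfl

lemma denseRange_toClosureRange (A : H →L[ℂ] H) : DenseRange (toClosureRange A) := by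
  intro x
  rw [closure_subtype]
  have hx : (x : H) ∈ closure (Set.range A) := by
    have := x.2
    rwa [← SetLike.mem_coe, Submodule.topologicalClosure_coe] at this
  rwa [← Set.range_comp]

/-- The defect operator `D_T = (I - T^* T)^{1/2}` of a contraction `T`. -/
def defect (T : H →L[ℂ] H) : H →L[ℂ] H :=
  CFC.sqrt (1 - adjoint T * T)

/-- The defect space `𝒟_T`, the closure of the range of `D_T`. -/
abbrev defectSpace (T : H →L[ℂ] H) : Submodule ℂ H := closureRange (defect T)

/-- The defect operator as a map `H → 𝒟_T`. -/
def toDefect (T : H →L[ℂ] H) : H →L[ℂ] defectSpace T := toClosureRange (defect T)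

lemma norm_sq_toDefect (T : H →L[ℂ] H) (hT : ‖T‖ ≤ 1) (h : H) :
    ‖toDefect T h‖ ^ 2 = ‖h‖ ^ 2 - ‖T h‖ ^ 2 := by
  have hpos : (0 : H →L[ℂ] H) ≤ 1 - adjoint T * T := by
    rw [ContinuousLinearMap.nonneg_iff_isPositive, ContinuousLinearMap.isPositive_def']
    refine ⟨?_, fun x => ?_⟩
    · have h1 : IsSelfAdjoint (adjoint T * T) := by
        rw [← ContinuousLinearMap.star_eq_adjoint]; exact IsSelfAdjoint.star_mul_self T
      exact (IsSelfAdjoint.one _).sub h1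
    · have h1 : ‖T x‖ ≤ ‖x‖ := by
        simpa using T.le_of_opNorm_le hT x
      have h2 : (ContinuousLinearMap.reApplyInnerSelf (1 - adjoint T * T) x)
          = ‖x‖ ^ 2 - ‖T x‖ ^ 2 := by
        simp only [ContinuousLinearMap.reApplyInnerSelf_apply, sub_apply,
          one_apply_eq_self, mul_apply_eq_comp, inner_sub_left,
          ContinuousLinearMap.adjoint_inner_left, map_sub, inner_self_eq_norm_sq]
      rw [h2]
      nlinarith [norm_nonneg (T x), norm_nonneg x]
  have hsq : defect T * defect T = 1 - adjoint T * T := CFC.sqrt_mul_sqrt_self _ hpos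
  have hsa : IsSelfAdjoint (defect T) := (CFC.sqrt_nonneg _).isSelfAdjoint
  have e1 : ‖toDefect T h‖ = ‖defect T h‖ := rfl
  rw [e1, ← inner_self_eq_norm_sq (𝕜 := ℂ) (defect T h), ← ContinuousLinearMap.adjoint_inner_left,
    ← ContinuousLinearMap.star_eq_adjoint, hsa.star_eq, ← mul_apply_eq_comp, hsq]
  simp only [sub_apply,
          one_apply_eq_self, mul_apply_eq_comp, inner_sub_left,
          ContinuousLinearMap.adjoint_inner_left, map_sub, inner_self_eq_norm_sq]

/-- Regularity (in the sense of Sz.-Nagy and Foias) of the factorization `A B` of a contraction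
into a product of two contractions: the vectors `D_A B h ⊕ D_B h` are dense in `𝒟_A ⊕ 𝒟_B`. -/
def IsRegularFactorization (A B : H →L[ℂ] H) : Prop :=
  DenseRange fun h : H =>
    (WithLp.toLp 2 (toDefect A (B h), toDefect B h) :
      WithLp 2 (defectSpace A × defectSpace B))

end Defect

/-! ### The vector-valued Hardy space -/

section Hardy

variable {F : Type*} [NormedAddCommGroup F] [InnerProductSpace ℂ F]

/-- The Hardy space `H²(F)`: an `F`-valued analytic function on the unit disk with norm-square
summable Taylor coefficients, represented by its sequence of Taylor coefficients. -/
abbrev HardySpace (F : Type*) [NormedAddCommGroup F] : Type _ := lp (fun _ : ℕ => F) 2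

/-- The value at `z` of the function with the given Taylor coefficients. -/
def HardySpace.eval (f : HardySpace F) (z : ℂ) : F := ∑' n, z ^ n • f n

/-- The forward shift `M_z`, on Taylor coefficients. -/
def shiftFun (f : ℕ → F) : ℕ → F
  | 0 => 0
  | n + 1 => f n

lemma hasSum_shiftFun (f : HardySpace F) :
    HasSum (fun n => ‖shiftFun f n‖ ^ 2) (‖f‖ ^ 2) := by
  have h := lp.hasSum_norm (p := 2) (by norm_num) f
  simp only [ENNReal.toReal_ofNat, Real.rpow_ofNat] at h
  rw [← hasSum_nat_add_iff' 1]
  simpa [shiftFun] using h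

/-- The forward shift `M_z` on `H²(F)`. -/
def shift : HardySpace F →ₗᵢ[ℂ] HardySpace F where
  toFun f := ⟨shiftFun f, memℓp_gen (by simpa using (hasSum_shiftFun f).summable)⟩
  map_add' f g := by
    ext n
    cases n
    · exact (add_zero (0 : F)).symm
    · rfl
  map_smul' c f := by
    ext n
    cases n <;> simp [shiftFun]
  norm_map' f := by
    have h := lp.hasSum_norm (p := 2) (by norm_num)
      (⟨shiftFun f, memℓp_gen (by simpa using (hasSum_shiftFun f).summable)⟩ : HardySpace F)
    simp only [ENNReal.toReal_ofNat, Real.rpow_ofNat] at h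
    exact (pow_left_inj₀ (norm_nonneg _) (norm_nonneg _) two_ne_zero).1
      (h.unique (hasSum_shiftFun f))

/-- The operator on `H²(F)` that applies `A` to the values (equivalently, to all Taylor
coefficients). -/
def pointwise (A : F →L[ℂ] F) : HardySpace F →L[ℂ] HardySpace F :=
  lp.mapCLM 2 (fun _ : ℕ => A) (norm_nonneg A) fun _ => le_rfl

/-- The multiplication operator `M_φ` on `H²(F)` with symbol `φ(z) = A + z B`. -/
def mulLinearSymbol (A B : F →L[ℂ] F) : HardySpace F →L[ℂ] HardySpace F :=
  pointwise A + shift.toContinuousLinearMap ∘L pointwise B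

lemma mulLinearSymbol_apply_zero (A B : F →L[ℂ] F) (f : HardySpace F) :
    mulLinearSymbol A B f 0 = A (f 0) := by
  change A (f 0) + 0 = A (f 0)
  rw [add_zero]

lemma mulLinearSymbol_apply_succ (A B : F →L[ℂ] F) (f : HardySpace F) (n : ℕ) :
    mulLinearSymbol A B f (n + 1) = A (f (n + 1)) + B (f n) := rfl

lemma HardySpace.summable_eval [CompleteSpace F] (f : HardySpace F) {z : ℂ} (hz : ‖z‖ < 1) :
    Summable fun n => z ^ n • f n := by
  refine Summable.of_norm_bounded (g := fun n => ‖z‖ ^ n * ‖f‖)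
    ((summable_geometric_of_lt_one (norm_nonneg z) hz).mul_right _) fun n => ?_
  rw [norm_smul, norm_pow]
  gcongr
  exact lp.norm_apply_le_norm (by norm_num) f n

/-- On functions, `mulLinearSymbol A B` is multiplication by `A + z B`. -/
lemma eval_mulLinearSymbol [CompleteSpace F] (A B : F →L[ℂ] F) (f : HardySpace F) {z : ℂ}
    (hz : ‖z‖ < 1) : (mulLinearSymbol A B f).eval z = (A + z • B) (f.eval z) := by
  have hf := f.summable_eval hz
  have h0 : (mulLinearSymbol A B f).eval z = A (f 0) +
      ∑' n, z ^ (n + 1) • (A (f (n + 1)) + B (f n)) := by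
    rw [HardySpace.eval, ((mulLinearSymbol A B f).summable_eval hz).tsum_eq_zero_add]
    simp [mulLinearSymbol_apply_zero, mulLinearSymbol_apply_succ]
  have hA : A (f.eval z) = A (f 0) + ∑' n, z ^ (n + 1) • A (f (n + 1)) := by
    rw [HardySpace.eval, A.map_tsum hf, (A.summable hf).tsum_eq_zero_add]
    simp
  have hB : z • B (f.eval z) = ∑' n, z ^ (n + 1) • B (f n) := by
    rw [HardySpace.eval, B.map_tsum hf, ← (B.summable hf).tsum_const_smul]
    simp [pow_succ', mul_smul]
  have sA : Summable fun n => z ^ (n + 1) • A (f (n + 1)) := by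
    simpa using (summable_nat_add_iff 1).2 (A.summable hf)
  have sB : Summable fun n => z ^ (n + 1) • B (f n) := by
    simpa [pow_succ', mul_smul] using (B.summable hf).const_smul z
  simp only [add_apply, smul_apply]
  rw [h0, hA, hB, add_assoc, ← sA.tsum_add sB]
  simp

/-- A vector `v` as the constant function `z ↦ v` in `H²(F)`. -/
def constantFun (F : Type*) [NormedAddCommGroup F] [InnerProductSpace ℂ F] : F →L[ℂ] HardySpace F :=
  lp.singleContinuousLinearMap ℂ (fun _ : ℕ => F) 2 0

end Hardy

/-! ### Unitary equivalence of dilations -/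

section Equivalence

variable {H K K' : Type*} [NormedAddCommGroup H] [InnerProductSpace ℂ H]
  [NormedAddCommGroup K] [InnerProductSpace ℂ K] [NormedAddCommGroup K'] [InnerProductSpace ℂ K']

/-- A pair of operators on `K` together with a map `H → K`: the data of a dilation, to `K`, of a
pair of operators on `H`. -/
structure PairOver (H K : Type*) [NormedAddCommGroup H] [InnerProductSpace ℂ H]
    [NormedAddCommGroup K] [InnerProductSpace ℂ K] where
  V₁ : K →L[ℂ] K
  V₂ : K →L[ℂ] K
  Pi : H →ₗ[ℂ] K

/-- Unitary equivalence of dilations: a unitary that intertwines both operators and carries one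
embedding of `H` to the other. -/
def PairOver.UnitarilyEquivalent (V : PairOver H K) (V' : PairOver H K') : Prop :=
  ∃ U : K ≃ₗᵢ[ℂ] K',
    (∀ x, U (V.V₁ x) = V'.V₁ (U x)) ∧ (∀ x, U (V.V₂ x) = V'.V₂ (U x)) ∧
      ∀ h, U (V.Pi h) = V'.Pi h

/-- The lower triangular block operator with rows `(A, 0)` and `(C, B)`. -/
def lowerBlock (A : K →L[ℂ] K) (C : K →L[ℂ] K') (B : K' →L[ℂ] K') :
    WithLp 2 (K × K') →L[ℂ] WithLp 2 (K × K') :=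
  ((WithLp.prodContinuousLinearEquiv 2 ℂ K K').symm : K × K' →L[ℂ] WithLp 2 (K × K')) ∘L
    ((A ∘L ContinuousLinearMap.fst ℂ K K').prod
      (C ∘L ContinuousLinearMap.fst ℂ K K' + B ∘L ContinuousLinearMap.snd ℂ K K')) ∘L
      (WithLp.prodContinuousLinearEquiv 2 ℂ K K' : WithLp 2 (K × K') →L[ℂ] K × K')

lemma lowerBlock_apply (A : K →L[ℂ] K) (C : K →L[ℂ] K') (B : K' →L[ℂ] K')
    (x : WithLp 2 (K × K')) :
    lowerBlock A C B x = WithLp.toLp 2 (A x.fst, C x.fst + B x.snd) := rfl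

end Equivalence

/-! ### Commuting contractions and Andô tuples -/

section Ando

variable {H : Type*} [NormedAddCommGroup H] [InnerProductSpace ℂ H] [CompleteSpace H]

/-- A pair `(T₁, T₂)` of commuting contractions on `H`. -/
structure CommutingContractions (H : Type*) [NormedAddCommGroup H] [InnerProductSpace ℂ H] where
  T₁ : H →L[ℂ] H
  T₂ : H →L[ℂ] H
  norm_T₁ : ‖T₁‖ ≤ 1
  norm_T₂ : ‖T₂‖ ≤ 1
  comm : T₁ * T₂ = T₂ * T₁

namespace CommutingContractions

/-- The product `T = T₁ T₂`. -/
def prod (T : CommutingContractions H) : H →L[ℂ] H := T.T₁ * T.T₂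

/-- The pair `(T₁^*, T₂^*)`. -/
def adj (T : CommutingContractions H) : CommutingContractions H where
  T₁ := adjoint T.T₁
  T₂ := adjoint T.T₂
  norm_T₁ := by simpa using T.norm_T₁
  norm_T₂ := by simpa using T.norm_T₂
  comm := by
    simp only [← ContinuousLinearMap.star_eq_adjoint, ← star_mul, T.comm]

lemma prod_adj (T : CommutingContractions H) : T.adj.prod = adjoint T.prod := by
  simp only [prod, adj, ← ContinuousLinearMap.star_eq_adjoint, ← star_mul, T.comm]

lemma norm_prod (T : CommutingContractions H) : ‖T.prod‖ ≤ 1 :=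
  (norm_mul_le _ _).trans (mul_le_one₀ T.norm_T₁ (norm_nonneg _) T.norm_T₂)

end CommutingContractions

/-- The space `ℱ = 𝒟_{T₁} ⊕ (𝒟_{T₂} ⊕ E)`, with an auxiliary Hilbert space `E`. -/
abbrev AuxSpace (T : CommutingContractions H) (E : Type*) [NormedAddCommGroup E] : Type _ :=
  WithLp 2 (defectSpace T.T₁ × WithLp 2 (defectSpace T.T₂ × E))

section

variable (T : CommutingContractions H) (E : Type*) [NormedAddCommGroup E] [InnerProductSpace ℂ E]
  [CompleteSpace E]

/-- The map `h ↦ D_{T₁} T₂ h ⊕ D_{T₂} h ⊕ 0`. -/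
def auxVec : H →ₗ[ℂ] AuxSpace T E where
  toFun h := WithLp.toLp 2 (toDefect T.T₁ (T.T₂ h), WithLp.toLp 2 (toDefect T.T₂ h, 0))
  map_add' x y := congrArg (WithLp.toLp 2) (Prod.ext (by simp)
    (congrArg (WithLp.toLp 2) (Prod.ext (by simp) (by simp))))
  map_smul' c x := congrArg (WithLp.toLp 2) (Prod.ext (by simp)
    (congrArg (WithLp.toLp 2) (Prod.ext (by simp) (by simp))))

lemma norm_auxVec (h : H) : ‖auxVec T E h‖ = ‖toDefect T.prod h‖ := by
  refine (pow_left_inj₀ (norm_nonneg _) (norm_nonneg _) two_ne_zero).1 ?_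
  rw [norm_sq_toDefect _ T.norm_prod, WithLp.prod_norm_sq_eq_of_L2]
  simp only [auxVec, WithLp.prod_norm_sq_eq_of_L2]
  change ‖toDefect T.T₁ (T.T₂ h)‖ ^ 2 + (‖toDefect T.T₂ h‖ ^ 2 + ‖(0 : E)‖ ^ 2) = _
  rw [norm_sq_toDefect _ T.norm_T₁, norm_sq_toDefect _ T.norm_T₂]
  simp [CommutingContractions.prod]

/-- The isometry `Λ : 𝒟_T → ℱ`, the continuous extension to `𝒟_T` of
`D_T h ↦ D_{T₁} T₂ h ⊕ D_{T₂} h`. -/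
def Lam : defectSpace T.prod →ₗᵢ[ℂ] AuxSpace T E where
  toLinearMap :=
    ((auxVec T E).extendOfNorm (toDefect T.prod : H →ₗ[ℂ] defectSpace T.prod)).toLinearMap
  norm_map' := by
    have hd : DenseRange (toDefect T.prod) := denseRange_toClosureRange _
    have hap : ∀ h, (auxVec T E).extendOfNorm (toDefect T.prod : H →ₗ[ℂ] defectSpace T.prod)
        (toDefect T.prod h) = auxVec T E h := fun h =>
      LinearMap.extendOfNorm_eq (e := (toDefect T.prod : H →ₗ[ℂ] defectSpace T.prod)) hd
        ⟨1, fun x => by simp [norm_auxVec]⟩ h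
    intro x
    refine hd.induction_on (p := fun x => ‖(auxVec T E).extendOfNorm
      (toDefect T.prod : H →ₗ[ℂ] defectSpace T.prod) x‖ = ‖x‖) x
      (isClosed_eq (by fun_prop) (by fun_prop)) fun h => ?_
    rw [hap, norm_auxVec]

lemma Lam_apply (h : H) : Lam T E (toDefect T.prod h) = auxVec T E h :=
  LinearMap.extendOfNorm_eq (e := (toDefect T.prod : H →ₗ[ℂ] defectSpace T.prod))
    (denseRange_toClosureRange _) ⟨1, fun x => by simp [norm_auxVec]⟩ h

/-- The orthogonal projection `P` of `ℱ` onto its summand `𝒟_{T₁}`. -/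
def auxProj : AuxSpace T E →L[ℂ] AuxSpace T E :=
  lowerBlock 1 0 0

lemma auxProj_apply (x : AuxSpace T E) : auxProj T E x = WithLp.toLp 2 (x.fst, 0) := by
  simp [auxProj, lowerBlock_apply]

end

/-- An Andô tuple of `(T₁, T₂)`. The space `ℱ`, the isometry `Λ` and the projection `P` are
`AuxSpace T E`, `Lam T E` and `auxProj T E`; what remains to be chosen is a unitary `U` on `ℱ`
that extends `D_{T₁} T₂ h ⊕ D_{T₂} h ↦ D_{T₁} h ⊕ D_{T₂} T₁ h`. An auxiliary summand `E ≠ 0` is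
added only if there is no such unitary on `𝒟_{T₁} ⊕ 𝒟_{T₂}` itself. -/
structure AndoTuple (T : CommutingContractions H) (E : Type*) [NormedAddCommGroup E]
    [InnerProductSpace ℂ E] where
  U : AuxSpace T E ≃ₗᵢ[ℂ] AuxSpace T E
  U_apply : ∀ h : H,
    U (WithLp.toLp 2 (toDefect T.T₁ (T.T₂ h), WithLp.toLp 2 (toDefect T.T₂ h, 0))) =
      WithLp.toLp 2 (toDefect T.T₁ h, WithLp.toLp 2 (toDefect T.T₂ (T.T₁ h), 0))
  only_if_needed : Nontrivial E →
    ¬ ∃ U₀ : WithLp 2 (defectSpace T.T₁ × defectSpace T.T₂) ≃ₗᵢ[ℂ]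
        WithLp 2 (defectSpace T.T₁ × defectSpace T.T₂),
      ∀ h : H, U₀ (WithLp.toLp 2 (toDefect T.T₁ (T.T₂ h), toDefect T.T₂ h)) =
        WithLp.toLp 2 (toDefect T.T₁ h, toDefect T.T₂ (T.T₁ h))

namespace AndoTuple

variable {T : CommutingContractions H} {E : Type*} [NormedAddCommGroup E] [InnerProductSpace ℂ E]
  [CompleteSpace E]

/-- The isometry `Λ : 𝒟_T → ℱ` of an Andô tuple. -/
def Λ (_A : AndoTuple T E) : defectSpace T.prod →ₗᵢ[ℂ] AuxSpace T E := Lam T E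

/-- The projection `P` of an Andô tuple. -/
def P (_A : AndoTuple T E) : AuxSpace T E →L[ℂ] AuxSpace T E := auxProj T E

/-- The operator `E₁ = P^⊥ U`. -/
def E₁ (A : AndoTuple T E) : AuxSpace T E →L[ℂ] AuxSpace T E :=
  (1 - A.P) * (A.U : AuxSpace T E →L[ℂ] AuxSpace T E)

/-- The operator `E₂ = U^* P`. -/
def E₂ (A : AndoTuple T E) : AuxSpace T E →L[ℂ] AuxSpace T E :=
  adjoint (A.U : AuxSpace T E →L[ℂ] AuxSpace T E) * A.P

end AndoTuple

end Ando

/-! ### The Schäffer-type dilation -/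

section Schaffer

variable {H : Type*} [NormedAddCommGroup H] [InnerProductSpace ℂ H] [CompleteSpace H]
  {T : CommutingContractions H} {E : Type*} [NormedAddCommGroup E] [InnerProductSpace ℂ E]
  [CompleteSpace E]

/-- The Schäffer-type dilation of `(T₁, T₂)` on `H ⊕ H²(ℱ)`: the block operators with rows
`(T₁, 0)`, `(E₂^* Λ D_T, M_{E₁ + z E₂^*})` and `(T₂, 0)`, `(E₁^* Λ D_T, M_{E₂ + z E₁^*})`, with
the canonical embedding of `H`. -/
def schafferDilation (A : AndoTuple T E) :
    PairOver H (WithLp 2 (H × HardySpace (AuxSpace T E))) where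
  V₁ := lowerBlock T.T₁
    (constantFun _ ∘L adjoint A.E₂ ∘L A.Λ.toContinuousLinearMap ∘L toDefect T.prod)
    (mulLinearSymbol A.E₁ (adjoint A.E₂))
  V₂ := lowerBlock T.T₂
    (constantFun _ ∘L adjoint A.E₁ ∘L A.Λ.toContinuousLinearMap ∘L toDefect T.prod)
    (mulLinearSymbol A.E₂ (adjoint A.E₁))
  Pi :=
    { toFun := fun h => WithLp.toLp 2 (h, 0)
      map_add' := fun x y => congrArg (WithLp.toLp 2) (Prod.ext (by simp) (by simp))
      map_smul' := fun c x => congrArg (WithLp.toLp 2) (Prod.ext (by simp) (by simp)) }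

end Schaffer

/-! ### The Douglas-type dilation -/

section Douglas

variable {H : Type*} [NormedAddCommGroup H] [InnerProductSpace ℂ H] [CompleteSpace H]

lemma norm_pow_le_one (T : H →L[ℂ] H) (hT : ‖T‖ ≤ 1) (n : ℕ) : ‖T ^ n‖ ≤ 1 := by
  induction n with
  | zero =>
    rw [pow_zero]
    exact ContinuousLinearMap.norm_id_le
  | succ n ih =>
    rw [pow_succ]
    exact (norm_mul_le _ _).trans (mul_le_one₀ ih (norm_nonneg _) hT)

lemma pow_add_apply (T : H →L[ℂ] H) (m n : ℕ) (h : H) :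
    (T ^ (m + n)) h = (T ^ m) ((T ^ n) h) := by
  rw [pow_add]
  rfl

lemma adjoint_pow (T : H →L[ℂ] H) (n : ℕ) : adjoint (T ^ n) = adjoint T ^ n := by
  simp only [← ContinuousLinearMap.star_eq_adjoint, star_pow]

/-- For a contraction `T`, the sequence `T^n T^{*n}` converges in the strong operator topology. -/
lemma exists_strongLimit (T : H →L[ℂ] H) (hT : ‖T‖ ≤ 1) :
    ∃ A : H →L[ℂ] H, ∀ h, Tendsto (fun n => (T ^ n) ((adjoint T ^ n) h)) atTop (𝓝 (A h)) := by
  have hS : ‖adjoint T‖ ≤ 1 := by simpa using hT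
  have hTn : ∀ n (x : H), ‖(T ^ n) x‖ ≤ ‖x‖ := fun n x => by
    simpa using (T ^ n).le_of_opNorm_le ((norm_pow_le_one T hT n)) x
  have hSn : ∀ n (x : H), ‖(adjoint T ^ n) x‖ ≤ ‖x‖ := fun n x => by
    simpa using (adjoint T ^ n).le_of_opNorm_le ((norm_pow_le_one _ hS n)) x
  have key : ∀ k (x : H),
      ‖x - (T ^ k) ((adjoint T ^ k) x)‖ ^ 2 ≤ ‖x‖ ^ 2 - ‖(adjoint T ^ k) x‖ ^ 2 := by
    intro k x
    rw [norm_sub_sq (𝕜 := ℂ), ← ContinuousLinearMap.adjoint_inner_left, adjoint_pow,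
      inner_self_eq_norm_sq]
    have := hTn k ((adjoint T ^ k) x)
    nlinarith [norm_nonneg ((T ^ k) ((adjoint T ^ k) x))]
  have hanti : ∀ h : H, Antitone fun n => ‖(adjoint T ^ n) h‖ ^ 2 := fun h =>
    antitone_nat_of_succ_le fun n => by
      have h1 := hSn 1 ((adjoint T ^ n) h)
      rw [← pow_add_apply, add_comm] at h1
      exact pow_le_pow_left₀ (norm_nonneg _) h1 2
  have hcau : ∀ h : H, CauchySeq fun n => (T ^ n) ((adjoint T ^ n) h) := by
    intro h
    have hc : CauchySeq fun n => ‖(adjoint T ^ n) h‖ ^ 2 :=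
      (tendsto_atTop_ciInf (hanti h) ⟨0, by rintro _ ⟨n, rfl⟩; positivity⟩).cauchySeq
    rw [Metric.cauchySeq_iff'] at hc ⊢
    intro ε hε
    obtain ⟨N, hN⟩ := hc (ε ^ 2) (by positivity)
    refine ⟨N, fun n hn => ?_⟩
    obtain ⟨k, rfl⟩ := Nat.exists_eq_add_of_le hn
    have h1 := hN (N + k) hn
    rw [dist_comm, Real.dist_eq] at h1
    have h2 := (le_abs_self _).trans_lt h1
    rw [dist_comm, dist_eq_norm]
    have h3 : (T ^ N) ((adjoint T ^ N) h) - (T ^ (N + k)) ((adjoint T ^ (N + k)) h) =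
        (T ^ N) ((adjoint T ^ N) h - (T ^ k) ((adjoint T ^ k) ((adjoint T ^ N) h))) := by
      rw [map_sub, pow_add_apply T N k, add_comm N k, pow_add_apply (adjoint T) k N]
    rw [h3]
    refine (hTn _ _).trans_lt ?_
    have h4 := key k ((adjoint T ^ N) h)
    rw [add_comm N k, pow_add_apply (adjoint T) k N] at h2
    exact lt_of_pow_lt_pow_left₀ 2 hε.le (h4.trans_lt h2)
  choose f hf using fun h => cauchySeq_tendsto_of_complete (hcau h)
  have hbd : ∀ h, ‖f h‖ ≤ 1 * ‖h‖ := fun h => by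
    rw [one_mul]
    exact le_of_tendsto' (hf h).norm fun n => (hTn n _).trans (hSn n h)
  have hadd : ∀ x y, f (x + y) = f x + f y := fun x y =>
    tendsto_nhds_unique (hf _) (((hf x).add (hf y)).congr fun n => by rw [map_add, map_add])
  have hsmul : ∀ (c : ℂ) x, f (c • x) = c • f x := fun c x =>
    tendsto_nhds_unique (hf _) (((hf x).const_smul c).congr fun n => by rw [map_smul, map_smul])
  exact ⟨LinearMap.mkContinuous ⟨⟨f, hadd⟩, hsmul⟩ 1 hbd, hf⟩

namespace CommutingContractions

variable (T : CommutingContractions H)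

/-- The positive operator `Q` with `Q²` the strong limit of `T^n T^{*n}`, where `T = T₁ T₂`. -/
def Q : H →L[ℂ] H := CFC.sqrt (exists_strongLimit T.prod T.norm_prod).choose

lemma norm_sq_Q (h : H) :
    Tendsto (fun n => ‖(adjoint T.prod ^ n) h‖ ^ 2) atTop (𝓝 (‖T.Q h‖ ^ 2)) := by
  set A := (exists_strongLimit T.prod T.norm_prod).choose with hA
  have hlim := (exists_strongLimit T.prod T.norm_prod).choose_spec
  rw [← hA] at hlim
  have hin : ∀ x, Tendsto (fun n => ((‖(adjoint T.prod ^ n) x‖ ^ 2 : ℝ) : ℂ)) atTop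
      (𝓝 (inner ℂ (A x) x)) := fun x => by
    refine ((hlim x).inner tendsto_const_nhds).congr fun n => ?_
    rw [← ContinuousLinearMap.adjoint_inner_right, adjoint_pow, inner_self_eq_norm_sq_to_K]
    norm_cast
  have hre : ∀ x, Tendsto (fun n => ‖(adjoint T.prod ^ n) x‖ ^ 2) atTop
      (𝓝 (RCLike.re (inner ℂ (A x) x))) := fun x =>
    (Complex.continuous_re.tendsto _).comp (hin x)
  have hpos : 0 ≤ A := by
    rw [ContinuousLinearMap.nonneg_iff_isPositive, ContinuousLinearMap.isPositive_iff_complex]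
    intro x
    refine ⟨?_, ge_of_tendsto' (hre x) fun n => by positivity⟩
    exact tendsto_nhds_unique ((Complex.continuous_ofReal.tendsto _).comp (hre x)) (hin x)
  have hsq : T.Q * T.Q = A := CFC.sqrt_mul_sqrt_self _ hpos
  have hsa : IsSelfAdjoint T.Q := (CFC.sqrt_nonneg _).isSelfAdjoint
  have : ‖T.Q h‖ ^ 2 = RCLike.re (inner ℂ (A h) h) := by
    rw [← inner_self_eq_norm_sq (𝕜 := ℂ) (T.Q h), ← ContinuousLinearMap.adjoint_inner_left,
      ← ContinuousLinearMap.star_eq_adjoint, hsa.star_eq, ← mul_apply_eq_comp, hsq]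
  rw [this]
  exact hre h

end CommutingContractions

/-- The unitary part of the Douglas-type dilation: a Hilbert space `R` that contains the closure
of the range of `Q`, and commuting unitaries `W₁, W₂` on `R` such that `W₁^*, W₂^*` extend the
isometries `X₁^*, X₂^*` given by `X_i^* Q = Q T_i^*`, and such that `(W₁ W₂)^*` is the minimal
unitary extension of `X₁^* X₂^*`. -/
structure UnitaryPart (T : CommutingContractions H) (R : Type*) [NormedAddCommGroup R]
    [InnerProductSpace ℂ R] where
  incl : closureRange T.Q →ₗᵢ[ℂ] R
  W₁ : R ≃ₗᵢ[ℂ] R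
  W₂ : R ≃ₗᵢ[ℂ] R
  comm : W₁ * W₂ = W₂ * W₁
  W₁_extends : ∀ h : H, W₁.symm (incl (toClosureRange T.Q h)) =
    incl (toClosureRange T.Q (adjoint T.T₁ h))
  W₂_extends : ∀ h : H, W₂.symm (incl (toClosureRange T.Q h)) =
    incl (toClosureRange T.Q (adjoint T.T₂ h))
  minimal : (Submodule.span ℂ
    {x : R | ∃ (n : ℤ) (y : closureRange T.Q), x = ((W₁ * W₂) ^ n) (incl y)}).topologicalClosure = ⊤

section

variable {T : CommutingContractions H} {E R : Type*} [NormedAddCommGroup E]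
  [InnerProductSpace ℂ E] [CompleteSpace E] [NormedAddCommGroup R] [InnerProductSpace ℂ R]

/-- The coefficients of the observability operator are norm-square summable. -/
lemma memℓp_observability (B : AndoTuple T.adj E) (h : H) :
    Memℓp (fun n : ℕ => B.Λ (toDefect T.adj.prod ((T.adj.prod ^ n) h))) 2 := by
  refine memℓp_gen ?_
  simp only [LinearIsometry.norm_map, ENNReal.toReal_ofNat, Real.rpow_ofNat,
    norm_sq_toDefect _ T.adj.norm_prod]
  refine summable_of_sum_range_le (c := ‖h‖ ^ 2) (fun n => ?_) fun n => ?_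
  · rw [← norm_sq_toDefect _ T.adj.norm_prod]
    positivity
  · have : ∀ m, T.adj.prod ((T.adj.prod ^ m) h) = (T.adj.prod ^ (m + 1)) h := fun m => by
      rw [pow_succ', mul_apply_eq_comp]
    simp only [this]
    rw [Finset.sum_range_sub' fun m => ‖(T.adj.prod ^ m) h‖ ^ 2]
    simp

/-- The function `z ↦ ∑ zⁿ Γ D_{T^*} T^{*n} h` in `H²(ℱ_*)`. -/
def observability (B : AndoTuple T.adj E) : H →ₗ[ℂ] HardySpace (AuxSpace T.adj E) where
  toFun h := ⟨fun n : ℕ => B.Λ (toDefect T.adj.prod ((T.adj.prod ^ n) h)),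
    memℓp_observability B h⟩
  map_add' x y := by
    ext n
    simp only [map_add]
    rfl
  map_smul' c x := by
    ext n
    simp only [map_smul]
    rfl

/-- The Douglas-type dilation of `(T₁, T₂)` on `H²(ℱ_*) ⊕ R`, built from an Andô tuple
`(ℱ_*, Γ, P', U')` of `(T₁^*, T₂^*)` with `H₁ = P'^⊥ U'`, `H₂ = U'^* P'`: the operators
`M_{H₁^* + z H₂} ⊕ W₁` and `M_{H₂^* + z H₁} ⊕ W₂`, with the embedding
`h ↦ (∑ zⁿ Γ D_{T^*} T^{*n} h) ⊕ Q h`. -/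
def douglasDilation (B : AndoTuple T.adj E) (Y : UnitaryPart T R) :
    PairOver H (WithLp 2 (HardySpace (AuxSpace T.adj E) × R)) where
  V₁ := lowerBlock (mulLinearSymbol (adjoint B.E₁) B.E₂) 0 (Y.W₁ : R →L[ℂ] R)
  V₂ := lowerBlock (mulLinearSymbol (adjoint B.E₂) B.E₁) 0 (Y.W₂ : R →L[ℂ] R)
  Pi :=
    { toFun := fun h => WithLp.toLp 2 (observability B h, Y.incl (toClosureRange T.Q h))
      map_add' := fun x y => congrArg (WithLp.toLp 2) (Prod.ext (by simp) (by simp))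
      map_smul' := fun c x => congrArg (WithLp.toLp 2) (Prod.ext (by simp) (by simp)) }

end

end Douglas

/-! ### Existence of the unitary part -/

section Existence

universe u

lemma exists_minimal_unitary_extension_aux {K D : Type u} [NormedAddCommGroup K]
    [InnerProductSpace ℂ K] [CompleteSpace K] [NormedAddCommGroup D] [InnerProductSpace ℂ D]
    [CompleteSpace D] (A : K →ₗᵢ[ℂ] K) (q : K →L[ℂ] K) (p : K →ₗ[ℂ] D) (j : D →ₗ[ℂ] K)
    (hAA : ∀ x, q (A x) = x) (hnorm : ∀ y, ‖p y‖ ^ 2 + ‖q y‖ ^ 2 = ‖y‖ ^ 2)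
    (hpA : ∀ x, p (A x) = 0) (hpD : ∀ d : D, p (j d) = d) (hqD : ∀ d : D, q (j d) = 0) :
    ∃ (R : Type u) (_ : NormedAddCommGroup R) (_ : InnerProductSpace ℂ R) (_ : CompleteSpace R)
      (ι : K →ₗᵢ[ℂ] R) (S : R ≃ₗᵢ[ℂ] R), (∀ x, S (ι (A x)) = ι x) ∧
      (Submodule.span ℂ {x : R | ∃ (n : ℕ) (y : K), x = (S ^ n) (ι y)}).topologicalClosure = ⊤ := by
  have horth : ∀ (d : HardySpace D) (a : D), ‖shift d + constantFun D a‖ ^ 2 = ‖d‖ ^ 2 + ‖a‖ ^ 2 := by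
    intro d a
    have h1 : inner ℂ (shift d) (constantFun D a) = 0 := by
      rw [constantFun, lp.singleContinuousLinearMap_apply, lp.inner_single_right]
      exact inner_zero_left _
    have h2 : ‖constantFun D a‖ = ‖a‖ := by
      rw [constantFun, lp.singleContinuousLinearMap_apply, lp.norm_single (by norm_num)]
    rw [norm_add_sq (𝕜 := ℂ), h1, h2, LinearIsometry.norm_map]
    simp
  let S₀ : WithLp 2 (HardySpace D × K) →ₗᵢ[ℂ] WithLp 2 (HardySpace D × K) :=
    { toFun := fun x => WithLp.toLp 2 (shift x.fst + constantFun D (p x.snd), q x.snd)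
      map_add' := fun x y => congrArg (WithLp.toLp 2) (Prod.ext
        (by simp only [WithLp.add_fst, WithLp.add_snd, map_add]; exact add_add_add_comm _ _ _ _)
        (by simp))
      map_smul' := fun c x => congrArg (WithLp.toLp 2) (Prod.ext
        (by simp only [WithLp.smul_fst, WithLp.smul_snd, map_smul]; exact (smul_add _ _ _).symm)
        (by simp))
      norm_map' := fun x => by
        refine (pow_left_inj₀ (norm_nonneg _) (norm_nonneg _) two_ne_zero).1 ?_
        rw [WithLp.prod_norm_sq_eq_of_L2 x, WithLp.prod_norm_sq_eq_of_L2]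
        change ‖shift x.fst + constantFun D (p x.snd)‖ ^ 2 + ‖q x.snd‖ ^ 2 = _
        rw [horth, add_assoc, hnorm] }
  have hS₀ : ∀ d y, S₀ (WithLp.toLp 2 (d, y)) =
    WithLp.toLp 2 (shift d + constantFun D (p y), q y) := fun _ _ => rfl
  have hsurj : Function.Surjective S₀ := by
    intro x
    have hsum : Memℓp (fun n => x.fst (n + 1)) 2 := by
      have h := lp.hasSum_norm (p := 2) (by norm_num) x.fst
      exact memℓp_gen ((summable_nat_add_iff 1).2 h.summable)
    refine ⟨WithLp.toLp 2 (⟨fun n => x.fst (n + 1), hsum⟩, A x.snd + j (x.fst 0)), ?_⟩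
    rw [hS₀]
    refine congrArg (WithLp.toLp 2) (Prod.ext ?_ ?_)
    · rw [map_add, hpA, hpD, zero_add]
      refine lp.ext (funext fun n => ?_)
      cases n with
      | zero =>
        change (0 : D) + (lp.single 2 0 (x.fst 0) : HardySpace D) 0 = x.fst 0
        rw [lp.single_apply_self, zero_add]
      | succ n =>
        change x.fst (n + 1) + (lp.single 2 0 (x.fst 0) : HardySpace D) (n + 1) = x.fst (n + 1)
        rw [lp.single_apply_ne _ _ _ (Nat.succ_ne_zero n), add_zero]
    · change q (A x.snd + j (x.fst 0)) = x.snd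
      rw [map_add, hAA, hqD, add_zero]
  let S : WithLp 2 (HardySpace D × K) ≃ₗᵢ[ℂ] WithLp 2 (HardySpace D × K) := LinearIsometryEquiv.ofSurjective S₀ hsurj
  have hS : ∀ d y, S (WithLp.toLp 2 (d, y)) =
    WithLp.toLp 2 (shift d + constantFun D (p y), q y) := hS₀
  let ι : K →ₗᵢ[ℂ] WithLp 2 (HardySpace D × K) :=
    { toFun := fun y => WithLp.toLp 2 (0, y)
      map_add' := fun x y => congrArg (WithLp.toLp 2) (Prod.ext (by simp) (by simp))
      map_smul' := fun c x => congrArg (WithLp.toLp 2) (Prod.ext (by simp) (by simp))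
      norm_map' := fun x => by
        refine (pow_left_inj₀ (norm_nonneg _) (norm_nonneg _) two_ne_zero).1 ?_
        rw [WithLp.prod_norm_sq_eq_of_L2]
        change ‖(0 : HardySpace D)‖ ^ 2 + ‖x‖ ^ 2 = _
        simp }
  refine ⟨WithLp 2 (HardySpace D × K), inferInstance, inferInstance, inferInstance, ι, S, fun x => ?_, ?_⟩
  · change S (WithLp.toLp 2 (0, A x)) = _
    rw [hS, hpA, hAA, map_zero, map_zero, add_zero]
    rfl
  · set M := (Submodule.span ℂ {x : WithLp 2 (HardySpace D × K) | ∃ (n : ℕ) (y : K), x = (S ^ n) (ι y)}).topologicalClosure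
    have hMc : IsClosed (M : Set (WithLp 2 (HardySpace D × K))) := Submodule.isClosed_topologicalClosure _
    have hgen : ∀ n y, (S ^ n) (ι y) ∈ M := fun n y =>
      Submodule.le_topologicalClosure _ (Submodule.subset_span ⟨n, y, rfl⟩)
    have hsingle : ∀ (n : ℕ) (d : D),
        (S ^ (n + 1)) (ι (j d)) = WithLp.toLp 2 ((lp.single 2 n d : HardySpace D), (0 : K)) := by
      intro n d
      induction n with
      | zero =>
        change S (WithLp.toLp 2 (0, j d)) = _
        rw [hS, hpD, map_zero, zero_add, hqD]
        rfl
      | succ n ih =>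
        rw [pow_succ']
        change S ((S ^ (n + 1)) (ι (j d))) = _
        rw [ih, hS, map_zero, map_zero, map_zero, add_zero]
        refine congrArg (WithLp.toLp 2) (Prod.ext (lp.ext (funext fun k => ?_)) rfl)
        cases k with
        | zero =>
          change (0 : D) = (lp.single 2 (n + 1) d : HardySpace D) 0
          rw [lp.single_apply_ne _ _ _ (Nat.succ_ne_zero n).symm]
        | succ k =>
          change (lp.single 2 n d : HardySpace D) k = (lp.single 2 (n + 1) d : HardySpace D) (k + 1)
          by_cases hk : k = n
          · subst hk
            rw [lp.single_apply_self, lp.single_apply_self]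
          · rw [lp.single_apply_ne _ _ _ hk, lp.single_apply_ne _ _ _ (by omega)]
    rw [eq_top_iff]
    rintro x -
    have hx : x = WithLp.toLp 2 (x.fst, (0 : K)) + ι x.snd :=
      congrArg (WithLp.toLp 2) (Prod.ext (add_zero x.fst).symm (zero_add x.snd).symm)
    rw [hx]
    refine M.add_mem ?_ (hgen 0 x.snd)
    let L : HardySpace D →L[ℂ] WithLp 2 (HardySpace D × K) :=
      ((WithLp.prodContinuousLinearEquiv 2 ℂ (HardySpace D) K).symm :
        HardySpace D × K →L[ℂ] WithLp 2 (HardySpace D × K)) ∘L ContinuousLinearMap.inl ℂ (HardySpace D) K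
    have hL : HasSum (fun n => L (lp.single 2 n (x.fst n))) (L x.fst) :=
      (lp.hasSum_single (by norm_num) x.fst).mapL L
    refine hMc.mem_of_tendsto hL (Eventually.of_forall fun s => M.sum_mem fun n _ => ?_)
    have h1 := hgen (n + 1) (j (x.fst n))
    rw [hsingle] at h1
    exact h1

/-- Every isometry has a unitary extension in which the inverse images of the original space are
dense. -/
lemma exists_minimal_unitary_extension {K : Type u} [NormedAddCommGroup K] [InnerProductSpace ℂ K]
    [CompleteSpace K] (A : K →ₗᵢ[ℂ] K) :
    ∃ (R : Type u) (_ : NormedAddCommGroup R) (_ : InnerProductSpace ℂ R) (_ : CompleteSpace R)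
      (ι : K →ₗᵢ[ℂ] R) (S : R ≃ₗᵢ[ℂ] R), (∀ x, S (ι (A x)) = ι x) ∧
      (Submodule.span ℂ {x : R | ∃ (n : ℕ) (y : K), x = (S ^ n) (ι y)}).topologicalClosure = ⊤ := by
  obtain ⟨q, hq⟩ : ∃ q : K →L[ℂ] K, q = adjoint A.toContinuousLinearMap := ⟨_, rfl⟩
  have hAA : ∀ x, q (A x) = x := fun x => by
    refine ext_inner_right ℂ fun y => ?_
    rw [hq, ContinuousLinearMap.adjoint_inner_left]
    exact A.inner_map_map x y
  have : CompleteSpace (LinearMap.ker (q : K →ₗ[ℂ] K)) := q.isClosed_ker.completeSpace_coe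
  have hmem : ∀ y, y - A (q y) ∈ LinearMap.ker (q : K →ₗ[ℂ] K) := fun y => by
    simp [hAA]
  have hnorm : ∀ y, ‖y - A (q y)‖ ^ 2 + ‖q y‖ ^ 2 = ‖y‖ ^ 2 := fun y => by
    have h2 : inner ℂ y (A (q y)) = inner ℂ (q y) (q y) := by
      nth_rewrite 2 [hq]
      exact (ContinuousLinearMap.adjoint_inner_left A.toContinuousLinearMap _ _).symm
    rw [norm_sub_sq (𝕜 := ℂ), h2, inner_self_eq_norm_sq, A.norm_map]
    ring
  obtain ⟨p, hp⟩ : ∃ p : K →ₗ[ℂ] LinearMap.ker (q : K →ₗ[ℂ] K), ∀ y, (p y : K) = y - A (q y) :=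
    ⟨LinearMap.codRestrict _ (LinearMap.id - A.toLinearMap ∘ₗ (q : K →ₗ[ℂ] K)) hmem, fun y => rfl⟩
  have hq0 : ∀ d : LinearMap.ker (q : K →ₗ[ℂ] K), q (d : K) = 0 := fun d => d.2
  refine exists_minimal_unitary_extension_aux A q p (Submodule.subtype _) hAA (fun y => ?_)
    (fun x => Subtype.ext ?_) (fun d => Subtype.ext ?_) hq0
  · rw [← hnorm y, ← hp y]; rfl
  · rw [hp, hAA, sub_self, Submodule.coe_zero]
  · rw [hp, Submodule.subtype_apply, hq0, map_zero, sub_zero]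

/-- Commuting isometries `A₁, A₂` have commuting unitary extensions whose product is the minimal
unitary extension of `A₁ A₂`. -/
lemma exists_commuting_unitary_extension {K : Type u} [NormedAddCommGroup K]
    [InnerProductSpace ℂ K] [CompleteSpace K] (A₁ A₂ : K →ₗᵢ[ℂ] K)
    (hcomm : ∀ x, A₁ (A₂ x) = A₂ (A₁ x)) :
    ∃ (R : Type u) (_ : NormedAddCommGroup R) (_ : InnerProductSpace ℂ R) (_ : CompleteSpace R)
      (ι : K →ₗᵢ[ℂ] R) (W₁ W₂ : R ≃ₗᵢ[ℂ] R), W₁ * W₂ = W₂ * W₁ ∧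
      (∀ x, W₁.symm (ι x) = ι (A₁ x)) ∧ (∀ x, W₂.symm (ι x) = ι (A₂ x)) ∧
      (Submodule.span ℂ {x : R | ∃ (n : ℤ) (y : K),
        x = ((W₁ * W₂) ^ n) (ι y)}).topologicalClosure = ⊤ := by
  obtain ⟨R, _, _, _, ι, S, hS, hdense⟩ := exists_minimal_unitary_extension (A₁.comp A₂)
  have hS' : ∀ x, S (ι (A₁ (A₂ x))) = ι x := hS
  have hsp : ∀ (n : ℕ) x, (S ^ (n + 1)) x = (S ^ n) (S x) := fun n x => by
    rw [pow_succ]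
    rfl
  -- the union of the increasing sequence of subspaces `S ^ n (ι K)`
  have hup : ∀ (m : ℕ) (y : K), ∀ n, ∃ z, (S ^ m) (ι y) = (S ^ (m + n)) (ι z) := by
    intro m y n
    induction n with
    | zero => exact ⟨y, rfl⟩
    | succ n ih =>
      obtain ⟨z, hz⟩ := ih
      exact ⟨A₁ (A₂ z), by rw [hz, ← add_assoc, hsp, hS']⟩
  let M : Submodule ℂ R :=
    { carrier := {x : R | ∃ (n : ℕ) (y : K), x = (S ^ n) (ι y)}
      zero_mem' := ⟨0, 0, by simp⟩
      add_mem' := by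
        rintro _ _ ⟨m, y, rfl⟩ ⟨n, z, rfl⟩
        obtain ⟨y', hy⟩ := hup m y n
        obtain ⟨z', hz⟩ := hup n z m
        exact ⟨m + n, y' + z', by rw [hy, hz, add_comm n m, map_add, map_add]⟩
      smul_mem' := by
        rintro c _ ⟨n, y, rfl⟩
        exact ⟨n, c • y, by rw [map_smul, map_smul]⟩ }
  have hM : Dense (M : Set R) := by
    have h1 : Submodule.span ℂ {x : R | ∃ (n : ℕ) (y : K), x = (S ^ n) (ι y)} = M :=
      Submodule.span_eq M
    rw [h1] at hdense
    rwa [Submodule.dense_iff_topologicalClosure_eq_top]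
  -- an isometry that commutes with `A₁ A₂` extends to `R`
  have hext : ∀ B : K →ₗᵢ[ℂ] K, (∀ x, A₁ (A₂ (B x)) = B (A₁ (A₂ x))) →
      ∃ f : R →ₗᵢ[ℂ] R, ∀ (m : ℕ) y, f ((S ^ m) (ι y)) = (S ^ m) (ι (B y)) := by
    intro B hB
    have hwd : ∀ (m n : ℕ) (y z : K), (S ^ m) (ι y) = (S ^ n) (ι z) →
        (S ^ m) (ι (B y)) = (S ^ n) (ι (B z)) := by
      have hlift : ∀ (m k : ℕ) (y : K), (S ^ m) (ι y) = (S ^ (m + k)) (ι ((A₁.comp A₂)^[k] y)) ∧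
          (S ^ m) (ι (B y)) = (S ^ (m + k)) (ι (B ((A₁.comp A₂)^[k] y))) := by
        intro m k y
        induction k with
        | zero => exact ⟨rfl, rfl⟩
        | succ k ih =>
          rw [Function.iterate_succ_apply', ← add_assoc, hsp, hsp, ih.1, ih.2]
          refine ⟨by rw [hS], ?_⟩
          change _ = (S ^ (m + k)) (S (ι (B (A₁ (A₂ _)))))
          rw [← hB, hS']
      intro m n y z h
      rw [(hlift m n y).1, (hlift n m z).1, add_comm n m] at h
      have h2 := ι.injective ((S ^ (m + n)).injective h)
      rw [(hlift m n y).2, (hlift n m z).2, add_comm n m, h2]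
    choose N Y hNY using fun x : M => x.2
    have hval : ∀ (m : ℕ) (y : K) (x : M), (x : R) = (S ^ m) (ι y) →
        (S ^ N x) (ι (B (Y x))) = (S ^ m) (ι (B y)) := fun m y x hx =>
      hwd _ _ _ _ ((hNY x).symm.trans hx)
    let g : M →ₗ[ℂ] R :=
      { toFun := fun x => (S ^ N x) (ι (B (Y x)))
        map_add' := fun x x' => by
          obtain ⟨y', hy⟩ := hup (N x) (Y x) (N x')
          obtain ⟨z', hz⟩ := hup (N x') (Y x') (N x)
          rw [add_comm (N x') (N x)] at hz
          rw [hval _ y' x ((hNY x).trans hy), hval _ z' x' ((hNY x').trans hz),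
            hval (N x + N x') (y' + z') (x + x')]
          · simp only [map_add]
          · rw [Submodule.coe_add, map_add, map_add, ← hy, ← hz, ← hNY x, ← hNY x']
        map_smul' := fun c x => by
          rw [hval (N x) (c • Y x) (c • x)]
          · simp only [map_smul, RingHom.id_apply]
          · rw [Submodule.coe_smul, map_smul, map_smul, ← hNY x] }
    have hg : ∀ x, ‖g x‖ = ‖M.subtype x‖ := fun x => by
      change ‖(S ^ N x) (ι (B (Y x)))‖ = ‖(x : R)‖
      rw [hNY x]
      simp only [LinearIsometryEquiv.norm_map, LinearIsometry.norm_map]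
    have hd : DenseRange M.subtype := by
      rw [DenseRange, Submodule.coe_subtype, Subtype.range_coe]
      exact hM
    have hap : ∀ x, g.extendOfNorm M.subtype (M.subtype x) = g x := fun x =>
      LinearMap.extendOfNorm_eq hd ⟨1, fun x => by rw [hg, one_mul]⟩ x
    refine ⟨⟨(g.extendOfNorm M.subtype).toLinearMap, fun x => ?_⟩, fun m y => ?_⟩
    · refine hd.induction_on (p := fun x => ‖g.extendOfNorm M.subtype x‖ = ‖x‖) x
        (isClosed_eq (by fun_prop) (by fun_prop)) fun h => ?_
      rw [hap, hg]
    · exact (hap ⟨(S ^ m) (ι y), m, y, rfl⟩).trans (hval _ _ _ rfl)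
  obtain ⟨f₁, hf₁⟩ := hext A₁ fun x => by rw [← hcomm, hcomm]
  obtain ⟨f₂, hf₂⟩ := hext A₂ fun x => by rw [hcomm]
  have hcl : ∀ f f' : R →ₗᵢ[ℂ] R, (∀ (m : ℕ) y, S (f (f' ((S ^ m) (ι y)))) = (S ^ m) (ι y)) →
      ∀ x, S (f (f' x)) = x := fun f f' h x => by
    have hc : IsClosed {x | S (f (f' x)) = x} :=
      isClosed_eq (S.continuous.comp (f.continuous.comp f'.continuous)) continuous_id
    refine hc.closure_subset_iff.2 ?_ (hM x)
    rintro _ ⟨m, y, rfl⟩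
    exact h m y
  have hSS : ∀ (m : ℕ) x, S ((S ^ m) x) = (S ^ m) (S x) := fun m x => by
    rw [← hsp, pow_succ']
    rfl
  have hf12 := hcl f₁ f₂ fun m y => by rw [hf₂, hf₁, hSS, hS']
  have hf21 := hcl f₂ f₁ fun m y => by rw [hf₁, hf₂, hSS, ← hcomm, hS']
  have hs₁ : Function.Surjective f₁ := fun x => ⟨f₂ (S x), S.injective (hf12 (S x))⟩
  have hs₂ : Function.Surjective f₂ := fun x => ⟨f₁ (S x), S.injective (hf21 (S x))⟩
  let W₁ : R ≃ₗᵢ[ℂ] R := (LinearIsometryEquiv.ofSurjective f₁ hs₁).symm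
  let W₂ : R ≃ₗᵢ[ℂ] R := (LinearIsometryEquiv.ofSurjective f₂ hs₂).symm
  have hW₁ : ∀ x, W₁ (f₁ x) = x := (LinearIsometryEquiv.ofSurjective f₁ hs₁).symm_apply_apply
  have hW₂ : ∀ x, W₂ (f₂ x) = x := (LinearIsometryEquiv.ofSurjective f₂ hs₂).symm_apply_apply
  have hW12 : W₁ * W₂ = S := LinearIsometryEquiv.ext fun x => by
    change W₁ (W₂ x) = S x
    have h := S.injective (hf21 (S x))
    conv_lhs => rw [← h]
    rw [hW₂, hW₁]
  have hW21 : W₂ * W₁ = S := LinearIsometryEquiv.ext fun x => by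
    change W₂ (W₁ x) = S x
    have h := S.injective (hf12 (S x))
    conv_lhs => rw [← h]
    rw [hW₁, hW₂]
  refine ⟨R, inferInstance, inferInstance, inferInstance, ι, W₁, W₂, hW12.trans hW21.symm,
    hf₁ 0, hf₂ 0, top_unique ?_⟩
  rw [← hdense, hW12]
  refine Submodule.topologicalClosure_mono (Submodule.span_mono ?_)
  rintro _ ⟨n, y, rfl⟩
  exact ⟨n, y, by rw [zpow_natCast]⟩

namespace CommutingContractions

variable {H : Type u} [NormedAddCommGroup H] [InnerProductSpace ℂ H] [CompleteSpace H]

/-- The isometries `X_i^*` with `X_i^* Q = Q T_i^*`. -/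
lemma exists_isometry_closureRange_Q (T : CommutingContractions H) (S : H →L[ℂ] H)
    (hS : ∀ h, ‖T.Q (S h)‖ = ‖T.Q h‖) :
    ∃ X : closureRange T.Q →ₗᵢ[ℂ] closureRange T.Q,
      ∀ h, X (toClosureRange T.Q h) = toClosureRange T.Q (S h) := by
  have hd : DenseRange (toClosureRange T.Q) := denseRange_toClosureRange _
  let e : H →ₗ[ℂ] closureRange T.Q := (toClosureRange T.Q : H →ₗ[ℂ] closureRange T.Q)
  have hn : ∀ x, ‖(e ∘ₗ (S : H →ₗ[ℂ] H)) x‖ ≤ 1 * ‖e x‖ := fun x => by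
    rw [one_mul]
    exact (hS x).le
  have hap : ∀ h, (e ∘ₗ (S : H →ₗ[ℂ] H)).extendOfNorm e (e h) = e (S h) := fun h =>
    LinearMap.extendOfNorm_eq (e := e) hd ⟨1, hn⟩ h
  refine ⟨⟨((e ∘ₗ (S : H →ₗ[ℂ] H)).extendOfNorm e).toLinearMap, fun x => ?_⟩, hap⟩
  refine hd.induction_on (p := fun x => ‖(e ∘ₗ (S : H →ₗ[ℂ] H)).extendOfNorm e x‖ = ‖x‖) x
    (isClosed_eq (by fun_prop) (by fun_prop)) fun h => ?_
  exact (congrArg _ (hap h)).trans (hS h)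

lemma norm_Q_adjoint (T : CommutingContractions H) (h : H) :
    ‖T.Q (adjoint T.T₁ h)‖ = ‖T.Q h‖ ∧ ‖T.Q (adjoint T.T₂ h)‖ = ‖T.Q h‖ := by
  have hle : ∀ S : H →L[ℂ] H, ‖S‖ ≤ 1 → Commute S (adjoint T.prod) → ∀ h,
      ‖T.Q (S h)‖ ≤ ‖T.Q h‖ := by
    intro S hS hc h
    refine le_of_sq_le_sq ?_ (norm_nonneg _)
    refine le_of_tendsto_of_tendsto' (T.norm_sq_Q _) (T.norm_sq_Q _) fun n => ?_
    have h1 : (adjoint T.prod ^ n) (S h) = S ((adjoint T.prod ^ n) h) :=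
      DFunLike.congr_fun (hc.pow_right n).eq.symm h
    have h2 : ‖S ((adjoint T.prod ^ n) h)‖ ≤ ‖(adjoint T.prod ^ n) h‖ := by
      have := S.le_of_opNorm_le hS ((adjoint T.prod ^ n) h)
      rwa [one_mul] at this
    rw [h1]
    exact pow_le_pow_left₀ (norm_nonneg _) h2 2
  have heq : ∀ h, ‖T.Q (adjoint T.prod h)‖ = ‖T.Q h‖ := fun h => by
    refine (pow_left_inj₀ (norm_nonneg _) (norm_nonneg _) two_ne_zero).1 ?_
    refine tendsto_nhds_unique (T.norm_sq_Q _) (((tendsto_add_atTop_iff_nat 1).2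
      (T.norm_sq_Q h)).congr fun n => ?_)
    rw [pow_add_apply, pow_one]
  have hcomm : Commute (adjoint T.T₁) (adjoint T.T₂) := T.adj.comm
  have hp : adjoint T.prod = adjoint T.T₁ * adjoint T.T₂ := T.prod_adj.symm
  have h1 : Commute (adjoint T.T₁) (adjoint T.prod) := hp ▸ (Commute.refl _).mul_right hcomm
  have h2 : Commute (adjoint T.T₂) (adjoint T.prod) := hp ▸ hcomm.symm.mul_right (Commute.refl _)
  have e1 : adjoint T.prod h = adjoint T.T₁ (adjoint T.T₂ h) := DFunLike.congr_fun hp h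
  have e2 : adjoint T.prod h = adjoint T.T₂ (adjoint T.T₁ h) :=
    DFunLike.congr_fun (hp.trans hcomm.eq) h
  have l1 := hle _ T.adj.norm_T₁ h1
  have l2 := hle _ T.adj.norm_T₂ h2
  refine ⟨le_antisymm (l1 h) ?_, le_antisymm (l2 h) ?_⟩
  · rw [← heq, e2]
    exact l2 _
  · rw [← heq, e1]
    exact l1 _

end CommutingContractions

variable {H : Type u} [NormedAddCommGroup H] [InnerProductSpace ℂ H] [CompleteSpace H]

/-- The unitary part of the Douglas-type dilation exists for every commuting pair. -/
theorem exists_unitaryPart (T : CommutingContractions H) :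
    ∃ (R : Type u) (_ : NormedAddCommGroup R) (_ : InnerProductSpace ℂ R) (_ : CompleteSpace R),
      Nonempty (UnitaryPart T R) := by
  obtain ⟨X₁, hX₁⟩ := T.exists_isometry_closureRange_Q _ fun h => (T.norm_Q_adjoint h).1
  obtain ⟨X₂, hX₂⟩ := T.exists_isometry_closureRange_Q _ fun h => (T.norm_Q_adjoint h).2
  have hcomm : ∀ x, X₁ (X₂ x) = X₂ (X₁ x) := fun x => by
    refine (denseRange_toClosureRange T.Q).induction_on (p := fun x => X₁ (X₂ x) = X₂ (X₁ x)) x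
      (isClosed_eq (X₁.continuous.comp X₂.continuous) (X₂.continuous.comp X₁.continuous))
      fun h => ?_
    have h1 : adjoint T.T₁ (adjoint T.T₂ h) = adjoint T.T₂ (adjoint T.T₁ h) :=
      DFunLike.congr_fun T.adj.comm h
    rw [hX₂, hX₁, hX₁, hX₂, h1]
  obtain ⟨R, i1, i2, i3, ι, W₁, W₂, hW, h1, h2, hmin⟩ :=
    exists_commuting_unitary_extension X₁ X₂ hcomm
  exact ⟨R, i1, i2, i3, ⟨ι, W₁, W₂, hW, fun h => by rw [h1, hX₁], fun h => by rw [h2, hX₂], hmin⟩⟩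

end Existence

end

end AndoDilation

universe u v₁ v₂ v₃

namespace AndoDilation

noncomputable section

set_option linter.unusedSectionVars false

/-! ### Regular factorizations -/

/-! Two facts carry the theorem: a symmetry of regularity under adjoints, and a uniqueness principle
for isometric lifts.

Regularity. By `isRegularFactorization_iff`, `A B` is regular exactly when `ran D_A` and `ran
D_{B^*}` meet only in `0`. This condition is symmetric under `(A, B) ↦ (B^*, A^*)`, so regularity of
`T₁^* T₂^*` is regularity of `T₂ T₁`. If both factorizations are regular, then `D_{T₁} T₂ h ⊕ D_{T₂}
h` and `D_{T₁} h ⊕ D_{T₂} T₁ h` are both dense in `𝒟_{T₁} ⊕ 𝒟_{T₂}`. They have the same norm, so the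
correspondence between them extends to a unitary. This gives Andô tuples with `E = 0` and forces
every Andô tuple to have `E = 0`, so `Λ` is an isometry with dense, hence full, range. The same
holds for `Γ`. Conversely, surjectivity of `Λ` makes the image of `D_{T₁} T₂ h ⊕ D_{T₂} h` dense in
`ℱ`, and this density restricts to the isometric copy of `𝒟_{T₁} ⊕ 𝒟_{T₂}`.

Uniqueness. Let commuting isometries `V₁, V₂` on `K ⊇ H` have adjoints extending `T₁^*, T₂^*`, and
let `K` be spanned by the vectors `(V₁ V₂)^n h`. All inner products between these vectors, and all
matrix entries of `V₁` and `V₂` on them, can be computed from `T₁, T₂` alone. Two such lifts are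
therefore unitarily equivalent (`IsMinimalIsometricLift.unitarilyEquivalent`), although only the
product `V₁ V₂` is assumed minimal.

Both dilations are lifts of this kind. The relations in `IsBCLPair` make the two multiplication
operators commuting isometries with product `M_z`. Surjectivity of `Λ` or `Γ` enters only in the
minimality: it makes the constants available, and the shift then fills the Hardy space. -/

/-- A solution of the Sylvester-type intertwining relation for squares of positive elements also
intertwines the positive elements themselves. -/
lemma mul_eq_mul_of_sq_intertwine {R : Type*} [CStarAlgebra R] [PartialOrder R] [StarOrderedRing R]
    {a b d : R} (ha : 0 ≤ a) (hd : 0 ≤ d) (h : a * a * b = b * (d * d)) : a * b = b * d := by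
  have ha' : star a = a := ha.isSelfAdjoint
  have hd' : star d = d := hd.isSelfAdjoint
  obtain ⟨X, hX⟩ : ∃ X, X = a * b - b * d := ⟨_, rfl⟩
  have h1 : a * X = -(X * d) := by
    rw [hX, mul_sub, sub_mul, ← mul_assoc, h]
    noncomm_ring
  -- The positive element `X^* a X` equals `-(X^* X) d`. Self-adjointness makes `X^* X` and `d`
  -- commute, so `X^* X d` is also positive; having both signs, it vanishes.
  have h2 : star X * a * X = -(star X * X * d) := by
    rw [mul_assoc, h1, mul_neg, mul_assoc]
  have h3 : 0 ≤ star X * a * X := star_left_conjugate_nonneg ha X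
  have h4 : Commute (star X * X) d := by
    have h5 := h3.isSelfAdjoint.star_eq
    rw [h2, star_neg, neg_inj, star_mul, star_mul, star_star, hd'] at h5
    exact h5.symm
  have h6 : star X * X * d = 0 := by
    refine le_antisymm ?_ (h4.mul_nonneg (star_mul_self_nonneg X) hd)
    rw [h2] at h3
    exact neg_nonneg.1 h3
  have h7 : X * d = 0 := by
    rw [← CStarRing.star_mul_self_eq_zero_iff, star_mul, mul_assoc, ← mul_assoc (star X), h6,
      mul_zero]
  have h8 : star X * a = 0 := by
    rw [← star_eq_zero, star_mul, ha', star_star, h1, h7, neg_zero]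
  have h9 : star X * X = -(star X * b * d) := by
    nth_rewrite 2 [hX]
    rw [mul_sub, ← mul_assoc, h8, zero_mul, zero_sub, mul_assoc]
  have h10 : star X * X = -(d * (star b * X)) := by
    have := congrArg star h9
    simpa [hd'] using this
  -- With `X d = 0` and `X^* a = 0`, expanding one factor `X` as `a b - b d` shows that `X^* X` has
  -- square zero, and a self-adjoint element with square zero is zero.
  have h11 : star (star X * X) * (star X * X) = 0 := by
    rw [star_mul, star_star]
    nth_rewrite 2 [h10]
    rw [mul_neg, ← mul_assoc, mul_assoc _ X d, h7, mul_zero, zero_mul, neg_zero]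
  rw [← sub_eq_zero, ← hX]
  exact CStarRing.star_mul_self_eq_zero_iff _ |>.1 (CStarRing.star_mul_self_eq_zero_iff _ |>.1 h11)

/-- A linear map with dense range is one whose range has trivial orthogonal complement. -/
lemma denseRange_iff_forall_inner_eq_zero {H K : Type*} [NormedAddCommGroup H]
    [InnerProductSpace ℂ H] [NormedAddCommGroup K] [InnerProductSpace ℂ K] [CompleteSpace K] (f : H →ₗ[ℂ] K) :
    DenseRange f ↔ ∀ x, (∀ h, inner ℂ (f h) x = 0) → x = 0 := by
  rw [DenseRange, ← LinearMap.coe_range, Submodule.dense_iff_topologicalClosure_eq_top,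
    Submodule.topologicalClosure_eq_top_iff, Submodule.eq_bot_iff]
  simp only [Submodule.mem_orthogonal, LinearMap.mem_range, forall_exists_index,
    forall_apply_eq_imp_iff]

section Defect

variable {H : Type*} [NormedAddCommGroup H] [InnerProductSpace ℂ H] [CompleteSpace H]

lemma one_sub_adjoint_mul_self_nonneg {T : H →L[ℂ] H} (hT : ‖T‖ ≤ 1) : 0 ≤ 1 - adjoint T * T := by
  rw [sub_nonneg, ← ContinuousLinearMap.star_eq_adjoint, ← CStarAlgebra.norm_le_one_iff_of_nonneg _
    (star_mul_self_nonneg T), CStarRing.norm_star_mul_self]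
  exact mul_le_one₀ hT (norm_nonneg _) hT

lemma defect_mul_self {T : H →L[ℂ] H} (hT : ‖T‖ ≤ 1) : defect T * defect T = 1 - adjoint T * T :=
  CFC.sqrt_mul_sqrt_self _ (one_sub_adjoint_mul_self_nonneg hT)

lemma defect_nonneg (T : H →L[ℂ] H) : 0 ≤ defect T := CFC.sqrt_nonneg _

lemma inner_defect_left (T : H →L[ℂ] H) (x y : H) :
    inner ℂ (defect T x) y = inner ℂ x (defect T y) := by
  have h : adjoint (defect T) = defect T := (defect_nonneg T).isSelfAdjoint
  rw [← ContinuousLinearMap.adjoint_inner_right, h]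

lemma defect_defect {T : H →L[ℂ] H} (hT : ‖T‖ ≤ 1) (x : H) :
    defect T (defect T x) = x - adjoint T (T x) :=
  DFunLike.congr_fun (defect_mul_self hT) x

/-- The intertwining relation `D_{T^*} T = T D_T`. -/
lemma defect_adjoint_apply {T : H →L[ℂ] H} (hT : ‖T‖ ≤ 1) (x : H) :
    defect (adjoint T) (T x) = T (defect T x) := by
  have hT' : ‖adjoint T‖ ≤ 1 := by simpa using hT
  refine DFunLike.congr_fun (mul_eq_mul_of_sq_intertwine (defect_nonneg (adjoint T))
    (defect_nonneg T) ?_) x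
  rw [defect_mul_self hT, defect_mul_self hT', adjoint_adjoint]
  noncomm_ring

/-- `D_T` is self-adjoint, so its kernel is orthogonal to the closure of its range. -/
lemma eq_zero_of_defect_eq_zero {T : H →L[ℂ] H} {u : H} (hu : u ∈ defectSpace T)
    (h : defect T u = 0) : u = 0 := by
  have h1 : ∀ v ∈ defectSpace T, inner ℂ u v = 0 := by
    intro v hv
    refine (denseRange_toClosureRange (defect T)).induction_on
      (p := fun v : defectSpace T => inner ℂ u (v : H) = 0) ⟨v, hv⟩
      (isClosed_eq (by fun_prop) continuous_const) fun w => ?_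
    rw [coe_toClosureRange, ← inner_defect_left, h, inner_zero_left]
  exact inner_self_eq_zero.1 (h1 u hu)

/-- A factorization `A B` is regular if and only if the ranges of `D_A` and `D_{B^*}` have trivial
intersection. -/
lemma isRegularFactorization_iff {A B : H →L[ℂ] H} (hB : ‖B‖ ≤ 1) :
    IsRegularFactorization A B ↔
      ∀ x y, defect A x = defect (adjoint B) y → defect A x = 0 := by
  have hB' : ‖adjoint B‖ ≤ 1 := by simpa using hB
  let f : H →ₗ[ℂ] WithLp 2 (defectSpace A × defectSpace B) :=
    { toFun := fun h => WithLp.toLp 2 (toDefect A (B h), toDefect B h)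
      map_add' := fun x y => congrArg (WithLp.toLp 2) (Prod.ext (by simp) (by simp))
      map_smul' := fun c x => congrArg (WithLp.toLp 2) (Prod.ext (by simp) (by simp)) }
  change DenseRange f ↔ _
  have hf : ∀ h z, inner ℂ (f h) z =
      inner ℂ h (adjoint B (defect A z.fst) + defect B z.snd) := fun h z => by
    rw [WithLp.prod_inner_apply, inner_add_right, ContinuousLinearMap.adjoint_inner_right,
      ← inner_defect_left, ← inner_defect_left]
    rfl
  constructor
  · intro hd x y hxy
    -- If `D_A x = D_{B^*} y`, then `x ⊕ -B^* y` annihilates every `D_A B h ⊕ D_B h`, because `D_B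
    -- B^* = B^* D_{B^*}`. Density extends this to the whole space, and testing on `D_A² x ⊕ 0`
    -- gives `‖D_A x‖² = 0`.
    have h1 : ∀ z : WithLp 2 (defectSpace A × defectSpace B),
        inner ℂ x (z.fst : H) - inner ℂ (adjoint B y) (z.snd : H) = 0 := by
      intro z
      refine hd.induction_on (p := fun z : WithLp 2 (defectSpace A × defectSpace B) =>
        inner ℂ x (z.fst : H) - inner ℂ (adjoint B y) (z.snd : H) = 0) z
        (isClosed_eq (by fun_prop) continuous_const) fun h => ?_
      change inner ℂ x (defect A (B h)) - inner ℂ (adjoint B y) (defect B h) = 0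
      have h2 := defect_adjoint_apply hB' y
      rw [adjoint_adjoint] at h2
      rw [← inner_defect_left, ← inner_defect_left, h2, hxy,
        ContinuousLinearMap.adjoint_inner_left, sub_self]
    have h3 := h1 (WithLp.toLp 2 (toDefect A (defect A x), 0))
    change inner ℂ x (defect A (defect A x)) - inner ℂ (adjoint B y) (0 : H) = 0 at h3
    rw [inner_zero_right, sub_zero, ← inner_defect_left] at h3
    exact inner_self_eq_zero.1 h3
  · intro hAB
    rw [denseRange_iff_forall_inner_eq_zero]
    intro z hz
    obtain ⟨u, hu⟩ : ∃ u : H, u = z.fst := ⟨_, rfl⟩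
    obtain ⟨v, hv⟩ : ∃ v : H, v = z.snd := ⟨_, rfl⟩
    -- Orthogonality of `u ⊕ v` to all `D_A B h ⊕ D_B h` says that this vector is orthogonal to
    -- every `h`, in particular to itself.
    have h1 : adjoint B (defect A u) + defect B v = 0 := by
      have h2 := hz (adjoint B (defect A u) + defect B v)
      rw [hf, ← hu, ← hv] at h2
      exact inner_self_eq_zero.1 h2
    -- Write `1 = D_{B^*}² + B B^*`, replace `B^* D_A u` by `-D_B v`, and use `B D_B = D_{B^*} B`.
    -- This puts `D_A u` in the range of `D_{B^*}`.
    have h3 : defect A u = defect (adjoint B) (defect (adjoint B) (defect A u) - B v) := by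
      rw [map_sub, defect_defect hB', adjoint_adjoint, defect_adjoint_apply hB,
        eq_neg_of_add_eq_zero_left h1]
      simp
    have h4 := hAB _ _ h3
    rw [h4, map_zero, zero_add] at h1
    have hu0 : z.fst = 0 := Subtype.ext (eq_zero_of_defect_eq_zero z.fst.2 (hu ▸ h4))
    have hv0 : z.snd = 0 := Subtype.ext (eq_zero_of_defect_eq_zero z.snd.2 (hv ▸ h1))
    exact congrArg (WithLp.toLp 2) (Prod.ext hu0 hv0)

/-- The factorization `A^* B^*` is regular if and only if the factorization `B A` is. -/
lemma isRegularFactorization_adjoint_iff {A B : H →L[ℂ] H} (hA : ‖A‖ ≤ 1) (hB : ‖B‖ ≤ 1) :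
    IsRegularFactorization (adjoint A) (adjoint B) ↔ IsRegularFactorization B A := by
  rw [isRegularFactorization_iff (by simpa using hB), isRegularFactorization_iff hA, adjoint_adjoint]
  exact ⟨fun h x y hxy => hxy.trans (h y x hxy.symm), fun h x y hxy => hxy.trans (h y x hxy.symm)⟩

end Defect

/-! ### Minimal isometric lifts of commuting pairs -/

section Orbit

variable {H K : Type*} [NormedAddCommGroup H] [InnerProductSpace ℂ H] [NormedAddCommGroup K]
  [InnerProductSpace ℂ K]

namespace PairOver

/-- The pair `(V₂, V₁)`. -/
def swap (V : PairOver H K) : PairOver H K where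
  V₁ := V.V₂
  V₂ := V.V₁
  Pi := V.Pi

/-- The vector `(V₁ V₂)^n h`. -/
def orbit (V : PairOver H K) (n : ℕ) : H →ₗ[ℂ] K :=
  ((V.V₁ * V.V₂) ^ n : K →L[ℂ] K) ∘ₗ V.Pi

@[simp] lemma orbit_zero (V : PairOver H K) (h : H) : V.orbit 0 h = V.Pi h := rfl

lemma orbit_succ (V : PairOver H K) (n : ℕ) (h : H) :
    V.orbit (n + 1) h = V.V₁ (V.V₂ (V.orbit n h)) := by
  simp only [orbit, pow_succ']
  rfl

/-- The combinations `∑ (V₁ V₂)^n h_n`. -/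
def orbitSum (V : PairOver H K) : (ℕ →₀ H) →ₗ[ℂ] K :=
  Finsupp.lsum ℂ V.orbit

lemma orbitSum_single (V : PairOver H K) (n : ℕ) (h : H) :
    V.orbitSum (Finsupp.single n h) = V.orbit n h := by
  simp [orbitSum]

end PairOver

end Orbit

section MinimalLift

variable {H K K' : Type*} [NormedAddCommGroup H] [InnerProductSpace ℂ H] [CompleteSpace H]
  [NormedAddCommGroup K] [InnerProductSpace ℂ K] [NormedAddCommGroup K'] [InnerProductSpace ℂ K']

/-- A pair of commuting isometries `(V₁, V₂)` on `K ⊇ H` that lifts `(T₁, T₂)`, in the sense that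
`V_i^*` extends `T_i^*`, and whose product is a minimal isometric lift of `T₁ T₂`. -/
structure IsMinimalIsometricLift (T : CommutingContractions H) (V : PairOver H K) : Prop where
  norm_V₁ : ∀ x, ‖V.V₁ x‖ = ‖x‖
  norm_V₂ : ∀ x, ‖V.V₂ x‖ = ‖x‖
  norm_Pi : ∀ h, ‖V.Pi h‖ = ‖h‖
  comm : ∀ x, V.V₁ (V.V₂ x) = V.V₂ (V.V₁ x)
  inner_V₁ : ∀ h x, inner ℂ (V.Pi h) (V.V₁ x) = inner ℂ (V.Pi (adjoint T.T₁ h)) x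
  inner_V₂ : ∀ h x, inner ℂ (V.Pi h) (V.V₂ x) = inner ℂ (V.Pi (adjoint T.T₂ h)) x
  minimal : ∀ M : Submodule ℂ K, IsClosed (M : Set K) → (∀ h, V.Pi h ∈ M) →
    (∀ x ∈ M, V.V₁ (V.V₂ x) ∈ M) → M = ⊤

namespace CommutingContractions

/-- The pair `(T₂, T₁)`. -/
def swap (T : CommutingContractions H) : CommutingContractions H where
  T₁ := T.T₂
  T₂ := T.T₁
  norm_T₁ := T.norm_T₂
  norm_T₂ := T.norm_T₁
  comm := T.comm.symm

end CommutingContractions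


open PairOver

namespace IsMinimalIsometricLift

variable {T : CommutingContractions H} {V : PairOver H K} {V' : PairOver H K'}

/-- Exchanging the two indices preserves all the conditions, so every statement about `V₁` also
yields one about `V₂`. -/
lemma swap (hV : IsMinimalIsometricLift T V) : IsMinimalIsometricLift T.swap V.swap where
  norm_V₁ := hV.norm_V₂
  norm_V₂ := hV.norm_V₁
  norm_Pi := hV.norm_Pi
  comm x := (hV.comm x).symm
  inner_V₁ := hV.inner_V₂
  inner_V₂ := hV.inner_V₁
  minimal M hM hPi h := hV.minimal M hM hPi fun x hx => by
    rw [hV.comm]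
    exact h x hx

lemma inner_map_map_V₁ (hV : IsMinimalIsometricLift T V) (x y : K) :
    inner ℂ (V.V₁ x) (V.V₁ y) = inner ℂ x y :=
  (⟨V.V₁.toLinearMap, hV.norm_V₁⟩ : K →ₗᵢ[ℂ] K).inner_map_map x y

lemma inner_map_map_V₂ (hV : IsMinimalIsometricLift T V) (x y : K) :
    inner ℂ (V.V₂ x) (V.V₂ y) = inner ℂ x y :=
  hV.swap.inner_map_map_V₁ x y

lemma inner_Pi_Pi (hV : IsMinimalIsometricLift T V) (h k : H) :
    inner ℂ (V.Pi h) (V.Pi k) = inner ℂ h k :=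
  (⟨V.Pi, hV.norm_Pi⟩ : H →ₗᵢ[ℂ] K).inner_map_map h k

lemma orbit_swap (hV : IsMinimalIsometricLift T V) (n : ℕ) (h : H) :
    V.swap.orbit n h = V.orbit n h := by
  induction n with
  | zero => rfl
  | succ n ih =>
    rw [orbit_succ, orbit_succ, ih, hV.comm]
    rfl

/-- Each factor `V₁ V₂` moves to the left as `T₂^* T₁^*` acting on `h`, so the inner product depends
only on `T₁` and `T₂`. -/
lemma inner_Pi_orbit (hV : IsMinimalIsometricLift T V) (hV' : IsMinimalIsometricLift T V')
    (n : ℕ) (h k : H) :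
    inner ℂ (V.Pi h) (V.orbit n k) = inner ℂ (V'.Pi h) (V'.orbit n k) := by
  induction n generalizing h with
  | zero => exact (hV.inner_Pi_Pi h k).trans (hV'.inner_Pi_Pi h k).symm
  | succ n ih => rw [orbit_succ, orbit_succ, hV.inner_V₁, hV'.inner_V₁, hV.inner_V₂,
      hV'.inner_V₂, ih]

/-- Common powers of the isometry `V₁ V₂` cancel until one exponent is zero. -/
lemma inner_orbit_orbit (hV : IsMinimalIsometricLift T V) (hV' : IsMinimalIsometricLift T V')
    (n m : ℕ) (h k : H) :
    inner ℂ (V.orbit n h) (V.orbit m k) = inner ℂ (V'.orbit n h) (V'.orbit m k) := by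
  induction n generalizing m with
  | zero => exact inner_Pi_orbit hV hV' m h k
  | succ n ih =>
    cases m with
    | zero =>
      rw [← inner_conj_symm, ← inner_conj_symm (V'.orbit _ _)]
      exact congrArg _ (inner_Pi_orbit hV hV' (n + 1) k h)
    | succ m =>
      simp only [orbit_succ, hV.inner_map_map_V₁, hV'.inner_map_map_V₁, hV.inner_map_map_V₂,
        hV'.inner_map_map_V₂, ih]

/-- This is why minimality of the product alone suffices. If `m = 0`, then `V₁` moves across as
`T₁^*`. Otherwise cancel `V₁` from both sides, which leaves an extra `V₂` on the left: it moves
across as `T₂^*` if `n = 0`, and cancels against a `V₂` on the right, after commuting, if `n > 0`.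
-/
lemma inner_orbit_V₁_orbit (hV : IsMinimalIsometricLift T V) (hV' : IsMinimalIsometricLift T V')
    (m n : ℕ) (k h : H) :
    inner ℂ (V.orbit m k) (V.V₁ (V.orbit n h)) =
      inner ℂ (V'.orbit m k) (V'.V₁ (V'.orbit n h)) := by
  induction m generalizing n with
  | zero =>
    rw [orbit_zero, orbit_zero, hV.inner_V₁, hV'.inner_V₁]
    exact inner_Pi_orbit hV hV' n _ h
  | succ m ih =>
    rw [orbit_succ, orbit_succ, hV.inner_map_map_V₁, hV'.inner_map_map_V₁]
    cases n with
    | zero =>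
      rw [← inner_conj_symm, ← inner_conj_symm (V'.V₂ _), orbit_zero, orbit_zero, hV.inner_V₂,
        hV'.inner_V₂]
      exact congrArg _ (inner_Pi_orbit hV hV' m _ k)
    | succ n =>
      rw [orbit_succ, orbit_succ, hV.comm, hV'.comm, hV.inner_map_map_V₂, hV'.inner_map_map_V₂, ih]

lemma denseRange_orbitSum (hV : IsMinimalIsometricLift T V) : DenseRange V.orbitSum := by
  rw [DenseRange, ← LinearMap.coe_range, Submodule.dense_iff_topologicalClosure_eq_top]
  refine hV.minimal _ (Submodule.isClosed_topologicalClosure _) (fun h => ?_) fun x hx => ?_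
  · exact Submodule.le_topologicalClosure _ ⟨Finsupp.single 0 h, orbitSum_single V 0 h⟩
  · rw [← SetLike.mem_coe, Submodule.topologicalClosure_coe] at hx ⊢
    refine map_mem_closure (f := fun x => V.V₁ (V.V₂ x))
      (V.V₁.continuous.comp V.V₂.continuous) hx ?_
    rintro _ ⟨a, rfl⟩
    refine ⟨a.mapDomain (· + 1), ?_⟩
    induction a using Finsupp.induction_linear with
    | zero => simp
    | add a b ha hb => simp only [Finsupp.mapDomain_add, map_add, ha, hb]
    | single n h => rw [Finsupp.mapDomain_single, orbitSum_single, orbitSum_single, orbit_succ]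

/-- Equal Gram matrices of the orbit vectors make the map from one span to the other well defined
and isometric. -/
lemma norm_orbitSum (hV : IsMinimalIsometricLift T V) (hV' : IsMinimalIsometricLift T V')
    (a : ℕ →₀ H) : ‖V'.orbitSum a‖ = ‖V.orbitSum a‖ := by
  have h : ∀ a b, inner ℂ (V.orbitSum a) (V.orbitSum b) =
      inner ℂ (V'.orbitSum a) (V'.orbitSum b) := by
    intro a b
    induction a using Finsupp.induction_linear with
    | zero => simp
    | add a a' ha ha' => simp only [map_add, inner_add_left, ha, ha']
    | single n h =>
      induction b using Finsupp.induction_linear with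
      | zero => simp
      | add b b' hb hb' => simp only [map_add, inner_add_right, hb, hb']
      | single m k => simp only [orbitSum_single, inner_orbit_orbit hV hV']
  rw [@norm_eq_sqrt_re_inner ℂ, @norm_eq_sqrt_re_inner ℂ, h]

lemma ext_inner_orbit (hV : IsMinimalIsometricLift T V) {x y : K}
    (h : ∀ n k, inner ℂ (V.orbit n k) x = inner ℂ (V.orbit n k) y) : x = y := by
  refine hV.denseRange_orbitSum.eq_of_inner_right ℂ fun a => ?_
  induction a using Finsupp.induction_linear with
  | zero => simp
  | add a b ha hb => simp only [map_add, inner_add_left, ha, hb]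
  | single n k => rw [orbitSum_single, h]

/-- `V₁` need not preserve the set of orbit vectors, so the identity is tested weakly: both sides
have the same inner products with a total set. -/
lemma map_V₁ (hV : IsMinimalIsometricLift T V) (hV' : IsMinimalIsometricLift T V')
    (U : K ≃ₗᵢ[ℂ] K') (hU : ∀ n h, U (V.orbit n h) = V'.orbit n h) (x : K) :
    U (V.V₁ x) = V'.V₁ (U x) := by
  refine hV.denseRange_orbitSum.induction_on (p := fun x => U (V.V₁ x) = V'.V₁ (U x)) x
    (isClosed_eq (U.continuous.comp V.V₁.continuous) (V'.V₁.continuous.comp U.continuous))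
    fun a => ?_
  induction a using Finsupp.induction_linear with
  | zero => simp
  | add a b ha hb => simp only [map_add, ha, hb]
  | single n h =>
    rw [orbitSum_single, hU]
    refine hV'.ext_inner_orbit fun m k => ?_
    rw [← inner_orbit_V₁_orbit hV hV', ← hU, U.inner_map_map]

/-- Two isometric lifts of the same commuting pair are unitarily equivalent as soon as the products
are minimal. -/
theorem unitarilyEquivalent [CompleteSpace K] [CompleteSpace K'] (hV : IsMinimalIsometricLift T V)
    (hV' : IsMinimalIsometricLift T V') : V.UnitarilyEquivalent V' := by
  -- Finitely supported sequences in `H` serve as a common formal model: both orbit sums have dense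
  -- range and induce the same seminorm on it.
  let U : K ≃ₗᵢ[ℂ] K' := (LinearEquiv.refl ℂ (ℕ →₀ H)).extendOfIsometry V.orbitSum V'.orbitSum
    hV.denseRange_orbitSum hV'.denseRange_orbitSum (norm_orbitSum hV hV')
  have hU : ∀ n h, U (V.orbit n h) = V'.orbit n h := fun n h => by
    have := LinearEquiv.extendOfIsometry_eq (LinearEquiv.refl ℂ (ℕ →₀ H)) V.orbitSum V'.orbitSum
      hV.denseRange_orbitSum hV'.denseRange_orbitSum (norm_orbitSum hV hV') (Finsupp.single n h)
    rwa [LinearEquiv.refl_apply, orbitSum_single, orbitSum_single] at this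
  exact ⟨U, map_V₁ hV hV' U hU, map_V₁ hV.swap hV'.swap U fun n h => by
    rw [hV.orbit_swap, hV'.orbit_swap, hU], hU 0⟩

end IsMinimalIsometricLift

end MinimalLift

/-! ### Multiplication operators on the Hardy space -/

section Hardy

variable {F : Type*} [NormedAddCommGroup F] [InnerProductSpace ℂ F]

@[simp] lemma shift_apply_zero (f : HardySpace F) : shift f 0 = 0 := rfl

@[simp] lemma shift_apply_succ (f : HardySpace F) (n : ℕ) : shift f (n + 1) = f n := rfl

@[simp] lemma constantFun_apply_zero (v : F) : constantFun F v 0 = v :=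
  lp.single_apply_self 2 (E := fun _ : ℕ => F) 0 v

@[simp] lemma constantFun_apply_succ (v : F) (n : ℕ) : constantFun F v (n + 1) = 0 :=
  lp.single_apply_ne 2 (E := fun _ : ℕ => F) 0 v (Nat.succ_ne_zero n)

lemma shift_single (n : ℕ) (v : F) :
    shift (lp.single 2 n v : HardySpace F) = lp.single 2 (n + 1) v := by
  refine lp.ext (funext fun k => ?_)
  cases k with
  | zero => rw [shift_apply_zero, lp.single_apply_ne _ _ _ (Nat.succ_ne_zero n).symm]
  | succ k =>
    rw [shift_apply_succ]
    by_cases hk : k = n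
    · subst hk
      rw [lp.single_apply_self, lp.single_apply_self]
    · rw [lp.single_apply_ne _ _ _ hk, lp.single_apply_ne _ _ _ (by omega)]

/-- A closed shift-invariant subspace of `H²(F)` that contains the constants is everything. -/
lemma HardySpace.eq_top_of_shift_invariant {M : Submodule ℂ (HardySpace F)}
    (hM : IsClosed (M : Set (HardySpace F))) (hc : ∀ v, constantFun F v ∈ M)
    (hs : ∀ f ∈ M, shift f ∈ M) : M = ⊤ := by
  have h : ∀ (n : ℕ) (v : F), (lp.single 2 n v : HardySpace F) ∈ M := by
    intro n v
    induction n with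
    | zero => exact hc v
    | succ n ih =>
      rw [← shift_single]
      exact hs _ ih
  exact eq_top_iff.2 fun f _ => hM.mem_of_tendsto (lp.hasSum_single (by norm_num) f)
    (Eventually.of_forall fun s => M.sum_mem fun n _ => h n (f n))

lemma HardySpace.hasSum_norm_sq (f : HardySpace F) : HasSum (fun n => ‖f n‖ ^ 2) (‖f‖ ^ 2) := by
  simpa using lp.hasSum_norm (p := 2) (by norm_num) f

/-- The hypotheses are the coefficients of `(A + zB)(C + zD) = AC + z(AD + BC) + z² BD`, required to
equal `z`. -/
lemma mulLinearSymbol_comp {A B C D : F →L[ℂ] F} (h₀ : A * C = 0) (h₁ : A * D + B * C = 1)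
    (h₂ : B * D = 0) (f : HardySpace F) :
    mulLinearSymbol A B (mulLinearSymbol C D f) = shift f := by
  have h₀' : ∀ v, A (C v) = 0 := DFunLike.congr_fun h₀
  have h₁' : ∀ v, A (D v) + B (C v) = v := DFunLike.congr_fun h₁
  have h₂' : ∀ v, B (D v) = 0 := DFunLike.congr_fun h₂
  refine lp.ext (funext fun n => ?_)
  match n with
  | 0 => simp only [mulLinearSymbol_apply_zero, h₀', shift_apply_zero]
  | 1 => simp only [mulLinearSymbol_apply_succ, mulLinearSymbol_apply_zero, map_add, h₀', zero_add,
      h₁', shift_apply_succ]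
  | n + 2 => simp only [mulLinearSymbol_apply_succ, map_add, h₀', zero_add, h₂', add_zero,
      h₁', shift_apply_succ]

lemma mulLinearSymbol_constantFun (A B : F →L[ℂ] F) (v : F) :
    mulLinearSymbol A B (constantFun F v) = constantFun F (A v) + shift (constantFun F (B v)) := by
  refine lp.ext (funext fun n => ?_)
  change _ = constantFun F (A v) n + shift (constantFun F (B v)) n
  match n with
  | 0 => simp [mulLinearSymbol_apply_zero]
  | 1 => simp [mulLinearSymbol_apply_succ]
  | n + 2 => simp [mulLinearSymbol_apply_succ]

variable [CompleteSpace F]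

/-- If the coefficients of `g` are those of `M_φ^* k`, where `φ(z) = A + z B`, then `M_φ^* k = g`
in the weak sense. -/
lemma inner_mulLinearSymbol {A B : F →L[ℂ] F} {g k : HardySpace F}
    (h : ∀ n, g n = adjoint A (k n) + adjoint B (k (n + 1))) (f : HardySpace F) :
    inner ℂ k (mulLinearSymbol A B f) = inner ℂ g f := by
  have h1 := lp.hasSum_inner (𝕜 := ℂ) k (pointwise A f)
  have h2 := lp.hasSum_inner (𝕜 := ℂ) k (shift (pointwise B f))
  -- The shifted term has zero constant coefficient, so dropping it pairs `B (f n)` with `k (n +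
  -- 1)`.
  rw [← hasSum_nat_add_iff' 1] at h2
  have h3 := h1.add h2
  simp only [Finset.range_one, Finset.sum_singleton, shift_apply_zero, inner_zero_right, sub_zero,
    shift_apply_succ] at h3
  rw [← inner_add_right] at h3
  refine h3.unique ((lp.hasSum_inner (𝕜 := ℂ) g f).congr_fun fun n => ?_)
  rw [h, inner_add_left, ContinuousLinearMap.adjoint_inner_left,
    ContinuousLinearMap.adjoint_inner_left]
  rfl

/-- Pairs of operators such that the operators of multiplication by `E₁ + z E₂^*` and `E₂ + z E₁^*`
are commuting isometries with product `M_z`, as in the theorem of Berger, Coburn and Lebow. -/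
structure IsBCLPair (E₁ E₂ : F →L[ℂ] F) : Prop where
  mul₁₂ : E₁ * E₂ = 0
  mul₂₁ : E₂ * E₁ = 0
  add₁ : E₁ * adjoint E₁ + adjoint E₂ * E₂ = 1
  add₂ : E₂ * adjoint E₂ + adjoint E₁ * E₁ = 1

namespace IsBCLPair

variable {E₁ E₂ : F →L[ℂ] F}

lemma swap (h : IsBCLPair E₁ E₂) : IsBCLPair E₂ E₁ := ⟨h.mul₂₁, h.mul₁₂, h.add₂, h.add₁⟩

lemma adjoint_mul_adjoint (h : IsBCLPair E₁ E₂) : adjoint E₁ * adjoint E₂ = 0 := by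
  simp only [← ContinuousLinearMap.star_eq_adjoint, ← star_mul, h.mul₂₁, star_zero]

lemma adj (h : IsBCLPair E₁ E₂) : IsBCLPair (adjoint E₁) (adjoint E₂) where
  mul₁₂ := h.adjoint_mul_adjoint
  mul₂₁ := h.swap.adjoint_mul_adjoint
  add₁ := by rw [adjoint_adjoint, adjoint_adjoint, add_comm, h.add₂]
  add₂ := by rw [adjoint_adjoint, adjoint_adjoint, add_comm, h.add₁]

/-- The pair `(P^⊥ U, U^* P)` built from a unitary `U` and an orthogonal projection `P`. -/
lemma of_unitary_of_projection {U P : F →L[ℂ] F} (hU : adjoint U * U = 1)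
    (hU' : U * adjoint U = 1) (hP : adjoint P = P) (hPP : P * P = P) :
    IsBCLPair ((1 - P) * U) (adjoint U * P) := by
  have hQ : (1 - P) * (1 - P) = 1 - P := by
    rw [mul_sub, mul_one, sub_mul, one_mul, hPP, sub_self, sub_zero]
  have hc : ∀ X Y : F →L[ℂ] F, X * U * (adjoint U * Y) = X * Y := fun X Y => by
    rw [mul_assoc, ← mul_assoc _ _ Y, hU', one_mul]
  have h₁ : adjoint ((1 - P) * U) = adjoint U * (1 - P) := by
    simp only [← ContinuousLinearMap.star_eq_adjoint] at hP ⊢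
    rw [star_mul, star_sub, star_one, hP]
  have h₂ : adjoint (adjoint U * P) = P * U := by
    simp only [← ContinuousLinearMap.star_eq_adjoint] at hP ⊢
    rw [star_mul, star_star, hP]
  refine ⟨?_, ?_, ?_, ?_⟩
  · rw [hc, sub_mul, one_mul, hPP, sub_self]
  · rw [mul_assoc, ← mul_assoc P, mul_sub, mul_one, hPP, sub_self, zero_mul, mul_zero]
  · rw [h₁, h₂, hc, hc, hQ, hPP, sub_add_cancel]
  · rw [h₁, h₂, mul_assoc, mul_assoc, ← mul_assoc P, ← mul_assoc (1 - P), hQ, hPP, ← mul_add,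
      ← add_mul, add_sub_cancel, one_mul, hU]

lemma mulLinearSymbol_mulLinearSymbol (h : IsBCLPair E₁ E₂) (f : HardySpace F) :
    mulLinearSymbol E₁ (adjoint E₂) (mulLinearSymbol E₂ (adjoint E₁) f) = shift f :=
  mulLinearSymbol_comp h.mul₁₂ h.add₁ h.swap.adjoint_mul_adjoint f

/-- The relation `E₁^* E₂^* = 0` makes the ranges of `E₁` and `E₂^*` orthogonal. -/
lemma norm_sq_add (h : IsBCLPair E₁ E₂) (u v : F) :
    ‖E₁ u + adjoint E₂ v‖ ^ 2 = ‖E₁ u‖ ^ 2 + ‖adjoint E₂ v‖ ^ 2 := by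
  have h1 : inner ℂ (E₁ u) (adjoint E₂ v) = 0 := by
    rw [← ContinuousLinearMap.adjoint_inner_right]
    have : adjoint E₁ (adjoint E₂ v) = 0 := DFunLike.congr_fun h.adjoint_mul_adjoint v
    rw [this, inner_zero_right]
  rw [norm_add_sq (𝕜 := ℂ), h1]
  simp

lemma norm_sq_add_norm_sq (h : IsBCLPair E₁ E₂) (u : F) :
    ‖E₁ u‖ ^ 2 + ‖adjoint E₂ u‖ ^ 2 = ‖u‖ ^ 2 := by
  have h1 : E₂ (adjoint E₂ u) + adjoint E₁ (E₁ u) = u := DFunLike.congr_fun h.add₂ u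
  have h2 := congrArg (fun v => RCLike.re (inner ℂ v u)) h1
  simp only [inner_add_left, map_add, ContinuousLinearMap.adjoint_inner_left] at h2
  rw [← ContinuousLinearMap.adjoint_inner_right] at h2
  simp only [inner_self_eq_norm_sq] at h2
  rw [← h2, add_comm]

/-- Every coefficient is a sum of a vector in `ran E₁` and one in `ran E₂^*`. The added constant
occupies the `E₂^*` slot in degree zero, which the factor `z` leaves free. The case `v = 0` is the
isometry of the multiplication operator; the general case gives that of the Schäffer block. -/
lemma norm_sq_constantFun_add (h : IsBCLPair E₁ E₂) (v : F) (f : HardySpace F) :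
    ‖constantFun F (adjoint E₂ v) + mulLinearSymbol E₁ (adjoint E₂) f‖ ^ 2 =
      ‖adjoint E₂ v‖ ^ 2 + ‖f‖ ^ 2 := by
  have h1 := HardySpace.hasSum_norm_sq (pointwise E₁ f)
  have h2 := HardySpace.hasSum_norm_sq (pointwise (adjoint E₂) f)
  have h3 : ‖pointwise E₁ f‖ ^ 2 + ‖pointwise (adjoint E₂) f‖ ^ 2 = ‖f‖ ^ 2 :=
    (h1.add h2).unique ((HardySpace.hasSum_norm_sq f).congr_fun fun n =>
      h.norm_sq_add_norm_sq (f n))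
  have h4 := HardySpace.hasSum_norm_sq
    (constantFun F (adjoint E₂ v) + mulLinearSymbol E₁ (adjoint E₂) f)
  -- The series for `E₂^* f` is not reindexed: coefficient `n + 1` of the product contains `E₁ (f (n
  -- + 1))` but `E₂^* (f n)`.
  rw [← hasSum_nat_add_iff' 1] at h1 h4
  have h5 : ∀ n, (constantFun F (adjoint E₂ v) + mulLinearSymbol E₁ (adjoint E₂) f) n =
      constantFun F (adjoint E₂ v) n + mulLinearSymbol E₁ (adjoint E₂) f n := fun _ => rfl
  simp only [h5, Finset.range_one, Finset.sum_singleton, constantFun_apply_succ, zero_add,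
    mulLinearSymbol_apply_succ, mulLinearSymbol_apply_zero, constantFun_apply_zero,
    h.norm_sq_add] at h1 h4
  have h6 := h4.unique (h1.add h2)
  rw [add_comm (adjoint E₂ v), h.norm_sq_add] at h6
  change _ = ‖pointwise E₁ f‖ ^ 2 - ‖E₁ (f 0)‖ ^ 2 + _ at h6
  linarith

lemma norm_mulLinearSymbol (h : IsBCLPair E₁ E₂) (f : HardySpace F) :
    ‖mulLinearSymbol E₁ (adjoint E₂) f‖ = ‖f‖ := by
  have h1 := h.norm_sq_constantFun_add 0 f
  rw [map_zero, map_zero, zero_add, norm_zero, zero_pow two_ne_zero, zero_add] at h1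
  exact (pow_left_inj₀ (norm_nonneg _) (norm_nonneg _) two_ne_zero).1 h1

end IsBCLPair

end Hardy

/-! ### The Schäffer-type dilation as a minimal isometric lift -/

section

variable {H : Type*} [NormedAddCommGroup H] [InnerProductSpace ℂ H] [CompleteSpace H]
  {T : CommutingContractions H} {E : Type*} [NormedAddCommGroup E] [InnerProductSpace ℂ E]
  [CompleteSpace E]

namespace AndoTuple

variable (A : AndoTuple T E)

lemma E₁_apply (y : AuxSpace T E) : A.E₁ y = WithLp.toLp 2 (0, (A.U y).snd) := by
  change A.U y - auxProj T E (A.U y) = _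
  rw [auxProj_apply]
  exact congrArg (WithLp.toLp 2) (Prod.ext (sub_self _) (sub_zero _))

lemma adjoint_P : adjoint A.P = A.P := by
  refine ((ContinuousLinearMap.eq_adjoint_iff _ _).2 fun x y => ?_).symm
  simp only [P, auxProj_apply, WithLp.prod_inner_apply, inner_zero_left, inner_zero_right]
  rfl

lemma P_mul_P : A.P * A.P = A.P := by
  ext1 x
  change auxProj T E (auxProj T E x) = auxProj T E x
  simp only [auxProj_apply]
  rfl

lemma adjoint_U_apply (y : AuxSpace T E) :
    adjoint (A.U : AuxSpace T E →L[ℂ] AuxSpace T E) y = A.U.symm y := by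
  rw [LinearIsometryEquiv.adjoint_eq_symm]
  rfl

lemma adjoint_U_mul_U : adjoint (A.U : AuxSpace T E →L[ℂ] AuxSpace T E) *
    (A.U : AuxSpace T E →L[ℂ] AuxSpace T E) = 1 := by
  ext1 x
  exact (A.adjoint_U_apply _).trans (A.U.symm_apply_apply x)

lemma U_mul_adjoint_U : (A.U : AuxSpace T E →L[ℂ] AuxSpace T E) *
    adjoint (A.U : AuxSpace T E →L[ℂ] AuxSpace T E) = 1 := by
  ext1 x
  exact (congrArg A.U (A.adjoint_U_apply x)).trans (A.U.apply_symm_apply x)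

lemma adjoint_E₁ : adjoint A.E₁ =
    adjoint (A.U : AuxSpace T E →L[ℂ] AuxSpace T E) * (1 - A.P) := by
  have h : star A.P = A.P := A.adjoint_P
  rw [E₁, ← ContinuousLinearMap.star_eq_adjoint, star_mul, star_sub, star_one, h]
  rfl

lemma adjoint_E₂ : adjoint A.E₂ = A.P * (A.U : AuxSpace T E →L[ℂ] AuxSpace T E) := by
  have h : star A.P = A.P := A.adjoint_P
  rw [E₂, ← ContinuousLinearMap.star_eq_adjoint, ← ContinuousLinearMap.star_eq_adjoint, star_mul,
    star_star, h]

lemma isBCLPair : IsBCLPair A.E₁ A.E₂ :=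
  IsBCLPair.of_unitary_of_projection A.adjoint_U_mul_U A.U_mul_adjoint_U A.adjoint_P A.P_mul_P

lemma adjoint_E₂_apply (y : AuxSpace T E) :
    adjoint A.E₂ y = WithLp.toLp 2 ((A.U y).fst, 0) := by
  rw [adjoint_E₂]
  exact auxProj_apply T E _

lemma adjoint_E₁_apply (y : AuxSpace T E) :
    adjoint A.E₁ y = A.U.symm (WithLp.toLp 2 (0, y.snd)) := by
  rw [adjoint_E₁, mul_apply_eq_comp, adjoint_U_apply]
  congr 1
  change y - auxProj T E y = _
  rw [auxProj_apply]
  exact congrArg (WithLp.toLp 2) (Prod.ext (sub_self _) (sub_zero _))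

lemma E₂_apply (y : AuxSpace T E) : A.E₂ y = A.U.symm (WithLp.toLp 2 (y.fst, 0)) := by
  rw [E₂, mul_apply_eq_comp, adjoint_U_apply]
  exact congrArg _ (auxProj_apply T E _)

lemma U_auxVec (h : H) : A.U (auxVec T E h) =
    WithLp.toLp 2 (toDefect T.T₁ h, WithLp.toLp 2 (toDefect T.T₂ (T.T₁ h), 0)) :=
  A.U_apply h

lemma adjoint_E₂_auxVec (h : H) :
    adjoint A.E₂ (auxVec T E h) = WithLp.toLp 2 (toDefect T.T₁ h, 0) := by
  rw [adjoint_E₂_apply, U_auxVec]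
  rfl

lemma adjoint_E₁_auxVec (h : H) : adjoint A.E₁ (auxVec T E h) =
    A.U.symm (WithLp.toLp 2 (0, WithLp.toLp 2 (toDefect T.T₂ h, 0))) :=
  A.adjoint_E₁_apply _

lemma Λ_toDefect (h : H) : A.Λ (toDefect T.prod h) = auxVec T E h := Lam_apply T E h

/-- Here `E₁ E₁^* = P^⊥`, and the first summand supplies the missing `𝒟_{T₁}` component. This is the
constant coefficient of `V₁ V₂` on `h`. -/
lemma adjoint_E₂_auxVec_add (h : H) :
    adjoint A.E₂ (auxVec T E (T.T₂ h)) + A.E₁ (adjoint A.E₁ (auxVec T E h)) = auxVec T E h := by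
  rw [adjoint_E₂_auxVec, adjoint_E₁_auxVec, E₁_apply, A.U.apply_symm_apply]
  exact congrArg (WithLp.toLp 2) (Prod.ext (add_zero _) (zero_add _))

/-- After applying `U` this is the defining property of `U`. Together with the preceding identity it
makes `V₁` and `V₂` commute. -/
lemma adjoint_E₁_auxVec_add (h : H) :
    adjoint A.E₁ (auxVec T E (T.T₁ h)) + A.E₂ (adjoint A.E₂ (auxVec T E h)) = auxVec T E h := by
  rw [adjoint_E₂_auxVec, adjoint_E₁_auxVec, E₂_apply, ← map_add, A.U.symm_apply_eq, U_auxVec]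
  exact congrArg (WithLp.toLp 2) (Prod.ext (zero_add _) (add_zero _))

end AndoTuple

lemma schafferDilation_V₁_apply (A : AndoTuple T E) (x : WithLp 2 (H × HardySpace (AuxSpace T E))) :
    (schafferDilation A).V₁ x = WithLp.toLp 2 (T.T₁ x.fst,
      constantFun _ (adjoint A.E₂ (auxVec T E x.fst)) +
        mulLinearSymbol A.E₁ (adjoint A.E₂) x.snd) := by
  rw [← A.Λ_toDefect]
  rfl

lemma schafferDilation_V₂_apply (A : AndoTuple T E) (x : WithLp 2 (H × HardySpace (AuxSpace T E))) :
    (schafferDilation A).V₂ x = WithLp.toLp 2 (T.T₂ x.fst,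
      constantFun _ (adjoint A.E₁ (auxVec T E x.fst)) +
        mulLinearSymbol A.E₂ (adjoint A.E₁) x.snd) := by
  rw [← A.Λ_toDefect]
  rfl

lemma schafferDilation_Pi_apply (A : AndoTuple T E) (h : H) :
    (schafferDilation A).Pi h = WithLp.toLp 2 (h, 0) := rfl

lemma schafferDilation_V₁_V₂_apply (A : AndoTuple T E)
    (x : WithLp 2 (H × HardySpace (AuxSpace T E))) :
    (schafferDilation A).V₁ ((schafferDilation A).V₂ x) = WithLp.toLp 2 (T.prod x.fst,
      constantFun _ (auxVec T E x.fst) + shift x.snd) := by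
  have h0 : adjoint A.E₂ (adjoint A.E₁ (auxVec T E x.fst)) = 0 :=
    DFunLike.congr_fun A.isBCLPair.swap.adjoint_mul_adjoint _
  rw [schafferDilation_V₂_apply, schafferDilation_V₁_apply]
  refine congrArg (WithLp.toLp 2) (Prod.ext rfl ?_)
  change constantFun _ (adjoint A.E₂ (auxVec T E (T.T₂ x.fst))) +
    mulLinearSymbol A.E₁ (adjoint A.E₂) (_ + _) = constantFun _ (auxVec T E x.fst) + shift x.snd
  rw [map_add, A.isBCLPair.mulLinearSymbol_mulLinearSymbol, mulLinearSymbol_constantFun, h0,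
    map_zero, map_zero, add_zero, ← add_assoc, ← map_add, A.adjoint_E₂_auxVec_add]

lemma schafferDilation_V₂_V₁_apply (A : AndoTuple T E)
    (x : WithLp 2 (H × HardySpace (AuxSpace T E))) :
    (schafferDilation A).V₂ ((schafferDilation A).V₁ x) = WithLp.toLp 2 (T.prod x.fst,
      constantFun _ (auxVec T E x.fst) + shift x.snd) := by
  have h0 : adjoint A.E₁ (adjoint A.E₂ (auxVec T E x.fst)) = 0 :=
    DFunLike.congr_fun A.isBCLPair.adjoint_mul_adjoint _
  rw [schafferDilation_V₁_apply, schafferDilation_V₂_apply]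
  refine congrArg (WithLp.toLp 2) (Prod.ext (DFunLike.congr_fun T.comm.symm x.fst) ?_)
  change constantFun _ (adjoint A.E₁ (auxVec T E (T.T₁ x.fst))) +
    mulLinearSymbol A.E₂ (adjoint A.E₁) (_ + _) = constantFun _ (auxVec T E x.fst) + shift x.snd
  rw [map_add, A.isBCLPair.swap.mulLinearSymbol_mulLinearSymbol, mulLinearSymbol_constantFun, h0,
    map_zero, map_zero, add_zero, ← add_assoc, ← map_add, A.adjoint_E₁_auxVec_add]

/-- If `Λ` is surjective, then the Schäffer-type dilation is a minimal isometric lift. -/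
lemma isMinimalIsometricLift_schafferDilation (A : AndoTuple T E) (hA : Function.Surjective A.Λ) :
    IsMinimalIsometricLift T (schafferDilation A) where
  norm_V₁ x := by
    refine (pow_left_inj₀ (norm_nonneg _) (norm_nonneg _) two_ne_zero).1 ?_
    rw [schafferDilation_V₁_apply, WithLp.prod_norm_sq_eq_of_L2, WithLp.prod_norm_sq_eq_of_L2 x]
    change ‖T.T₁ x.fst‖ ^ 2 + ‖_ + _‖ ^ 2 = _
    rw [A.isBCLPair.norm_sq_constantFun_add, A.adjoint_E₂_auxVec, WithLp.norm_toLp_fst,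
      norm_sq_toDefect _ T.norm_T₁]
    ring
  norm_V₂ x := by
    refine (pow_left_inj₀ (norm_nonneg _) (norm_nonneg _) two_ne_zero).1 ?_
    rw [schafferDilation_V₂_apply, WithLp.prod_norm_sq_eq_of_L2, WithLp.prod_norm_sq_eq_of_L2 x]
    change ‖T.T₂ x.fst‖ ^ 2 + ‖_ + _‖ ^ 2 = _
    rw [A.isBCLPair.swap.norm_sq_constantFun_add, A.adjoint_E₁_auxVec,
      LinearIsometryEquiv.norm_map, WithLp.norm_toLp_snd, WithLp.norm_toLp_fst,
      norm_sq_toDefect _ T.norm_T₂]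
    ring
  norm_Pi h := WithLp.norm_toLp_fst 2 _ _ h
  comm x := by rw [schafferDilation_V₁_V₂_apply, schafferDilation_V₂_V₁_apply]
  inner_V₁ h x := by
    rw [schafferDilation_V₁_apply, schafferDilation_Pi_apply, schafferDilation_Pi_apply,
      WithLp.prod_inner_apply, WithLp.prod_inner_apply]
    simp only [inner_zero_left, add_zero, ContinuousLinearMap.adjoint_inner_left]
    rfl
  inner_V₂ h x := by
    rw [schafferDilation_V₂_apply, schafferDilation_Pi_apply, schafferDilation_Pi_apply,
      WithLp.prod_inner_apply, WithLp.prod_inner_apply]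
    simp only [inner_zero_left, add_zero, ContinuousLinearMap.adjoint_inner_left]
    rfl
  minimal M hM hPi hV := by
    let j : HardySpace (AuxSpace T E) →ₗᵢ[ℂ] WithLp 2 (H × HardySpace (AuxSpace T E)) :=
      { toFun := fun f => WithLp.toLp 2 (0, f)
        map_add' := fun x y => congrArg (WithLp.toLp 2) (Prod.ext (by simp) (by simp))
        map_smul' := fun c x => congrArg (WithLp.toLp 2) (Prod.ext (by simp) (by simp))
        norm_map' := fun f => WithLp.norm_toLp_snd 2 _ _ f }
    have hc : ∀ v, j (constantFun _ v) ∈ M := by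
      intro v
      obtain ⟨d, rfl⟩ := hA v
      refine (denseRange_toClosureRange (defect T.prod)).induction_on
        (p := fun d => j (constantFun _ (A.Λ d)) ∈ M) d
        (hM.preimage (j.continuous.comp ((constantFun _).continuous.comp A.Λ.continuous)))
        fun h => ?_
      -- `V₁ V₂ Π h - Π T h = 0 ⊕ Λ D_T h`, a constant function. By surjectivity of `Λ` such
      -- constants are dense among all constants.
      have h1 := M.sub_mem (hV _ (hPi h)) (hPi (T.prod h))
      rw [schafferDilation_V₁_V₂_apply, schafferDilation_Pi_apply] at h1
      change j (constantFun _ (A.Λ (toDefect T.prod h))) ∈ M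
      rw [A.Λ_toDefect]
      convert h1 using 1
      refine congrArg (WithLp.toLp 2) (Prod.ext (sub_self _).symm ?_)
      change _ = constantFun _ (auxVec T E h) + shift 0 - 0
      rw [map_zero, add_zero, sub_zero]
    have htop : M.comap j.toLinearMap = ⊤ :=
      HardySpace.eq_top_of_shift_invariant (hM.preimage j.continuous) hc fun f hf => by
        have h1 := hV _ hf
        rw [schafferDilation_V₁_V₂_apply] at h1
        change j (shift f) ∈ M
        convert h1 using 1
        refine congrArg (WithLp.toLp 2) (Prod.ext (map_zero _).symm ?_)
        change _ = constantFun _ (auxVec T E 0) + shift f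
        rw [map_zero, map_zero, zero_add]
    refine eq_top_iff.2 fun x _ => ?_
    have h1 : j x.snd ∈ M := (htop ▸ Submodule.mem_top : x.snd ∈ M.comap j.toLinearMap)
    convert M.add_mem (hPi x.fst) h1 using 1
    exact congrArg (WithLp.toLp 2) (Prod.ext (add_zero _).symm (zero_add _).symm)

end

/-! ### The Douglas-type dilation as a minimal isometric lift -/

section

variable {H : Type*} [NormedAddCommGroup H] [InnerProductSpace ℂ H] [CompleteSpace H]
  {T : CommutingContractions H} {E : Type*} [NormedAddCommGroup E] [InnerProductSpace ℂ E]
  [CompleteSpace E]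

namespace CommutingContractions

lemma prod_pow_T₁_apply (T : CommutingContractions H) (n : ℕ) (h : H) :
    (T.prod ^ n) (T.T₁ h) = T.T₁ ((T.prod ^ n) h) := by
  have h1 : Commute T.T₁ T.prod := (Commute.refl _).mul_right T.comm
  exact DFunLike.congr_fun (h1.symm.pow_left n).eq h

lemma prod_pow_T₂_apply (T : CommutingContractions H) (n : ℕ) (h : H) :
    (T.prod ^ n) (T.T₂ h) = T.T₂ ((T.prod ^ n) h) := by
  have h1 : Commute T.T₂ T.prod := Commute.mul_right (Eq.symm T.comm) (Commute.refl _)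
  exact DFunLike.congr_fun (h1.symm.pow_left n).eq h

end CommutingContractions

namespace AndoTuple

variable (A : AndoTuple T E)

/-- For the tuple of `(T₁^*, T₂^*)`, this is the coefficientwise form of the statement that the
adjoint of multiplication by `H₁^* + z H₂` sends the observability function of `h` to that of `T₁^*
h`. -/
lemma E₁_auxVec_add (h : H) :
    A.E₁ (auxVec T E h) + adjoint A.E₂ (auxVec T E (T.prod h)) = auxVec T E (T.T₁ h) := by
  have h1 : T.prod h = T.T₂ (T.T₁ h) := DFunLike.congr_fun T.comm h
  rw [E₁_apply, U_auxVec, adjoint_E₂_auxVec, h1]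
  exact congrArg (WithLp.toLp 2) (Prod.ext (zero_add _) (add_zero _))

lemma E₂_auxVec_add (h : H) :
    A.E₂ (auxVec T E h) + adjoint A.E₁ (auxVec T E (T.prod h)) = auxVec T E (T.T₂ h) := by
  rw [adjoint_E₁_auxVec, E₂_apply, ← map_add, A.U.symm_apply_eq, U_auxVec]
  exact congrArg (WithLp.toLp 2) (Prod.ext (add_zero _) (zero_add _))

end AndoTuple

lemma observability_apply (B : AndoTuple T.adj E) (h : H) (n : ℕ) :
    observability B h n = auxVec T.adj E ((T.adj.prod ^ n) h) :=
  B.Λ_toDefect _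

lemma observability_eq (B : AndoTuple T.adj E) (h : H) :
    observability B h = constantFun _ (auxVec T.adj E h) +
      shift (observability B (T.adj.prod h)) := by
  refine lp.ext (funext fun n => ?_)
  change _ = constantFun _ (auxVec T.adj E h) n + shift (observability B (T.adj.prod h)) n
  cases n with
  | zero => rw [constantFun_apply_zero, shift_apply_zero, observability_apply, add_zero]; rfl
  | succ n => rw [constantFun_apply_succ, shift_apply_succ, observability_apply,
      observability_apply, zero_add, pow_add_apply, pow_one]

/-- The sum telescopes: the first `n` coefficients contribute `‖h‖² - ‖T^{*n} h‖²`, and `‖T^{*n}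
h‖²` tends to `‖Q h‖²`. -/
lemma norm_sq_observability_add (B : AndoTuple T.adj E) (h : H) :
    ‖observability B h‖ ^ 2 + ‖T.Q h‖ ^ 2 = ‖h‖ ^ 2 := by
  have h1 := (HardySpace.hasSum_norm_sq (observability B h)).tendsto_sum_nat
  have h2 : ∀ n, ∑ i ∈ Finset.range n, ‖observability B h i‖ ^ 2 +
      ‖(adjoint T.prod ^ n) h‖ ^ 2 = ‖h‖ ^ 2 := by
    intro n
    induction n with
    | zero => simp
    | succ n ih =>
      rw [Finset.sum_range_succ, observability_apply, norm_auxVec,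
        norm_sq_toDefect _ T.adj.norm_prod, T.prod_adj, add_comm n 1, pow_add_apply, pow_one, ← ih]
      ring
  exact tendsto_nhds_unique ((h1.add (T.norm_sq_Q h)).congr h2) tendsto_const_nhds

variable {R : Type*} [NormedAddCommGroup R] [InnerProductSpace ℂ R]

lemma douglasDilation_V₁_apply (B : AndoTuple T.adj E) (Y : UnitaryPart T R)
    (x : WithLp 2 (HardySpace (AuxSpace T.adj E) × R)) : (douglasDilation B Y).V₁ x =
      WithLp.toLp 2 (mulLinearSymbol (adjoint B.E₁) B.E₂ x.fst, Y.W₁ x.snd) :=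
  congrArg (WithLp.toLp 2) (Prod.ext rfl (zero_add _))

lemma douglasDilation_V₂_apply (B : AndoTuple T.adj E) (Y : UnitaryPart T R)
    (x : WithLp 2 (HardySpace (AuxSpace T.adj E) × R)) : (douglasDilation B Y).V₂ x =
      WithLp.toLp 2 (mulLinearSymbol (adjoint B.E₂) B.E₁ x.fst, Y.W₂ x.snd) :=
  congrArg (WithLp.toLp 2) (Prod.ext rfl (zero_add _))

lemma douglasDilation_Pi_apply (B : AndoTuple T.adj E) (Y : UnitaryPart T R) (h : H) :
    (douglasDilation B Y).Pi h =
      WithLp.toLp 2 (observability B h, Y.incl (toClosureRange T.Q h)) := rfl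

lemma douglasDilation_V₁_V₂_apply (B : AndoTuple T.adj E) (Y : UnitaryPart T R)
    (x : WithLp 2 (HardySpace (AuxSpace T.adj E) × R)) :
    (douglasDilation B Y).V₁ ((douglasDilation B Y).V₂ x) =
      WithLp.toLp 2 (shift x.fst, (Y.W₁ * Y.W₂) x.snd) := by
  have h := B.isBCLPair.adj.mulLinearSymbol_mulLinearSymbol x.fst
  rw [adjoint_adjoint, adjoint_adjoint] at h
  rw [douglasDilation_V₂_apply, douglasDilation_V₁_apply, ← h]
  rfl

lemma douglasDilation_V₂_V₁_apply (B : AndoTuple T.adj E) (Y : UnitaryPart T R)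
    (x : WithLp 2 (HardySpace (AuxSpace T.adj E) × R)) :
    (douglasDilation B Y).V₂ ((douglasDilation B Y).V₁ x) =
      WithLp.toLp 2 (shift x.fst, (Y.W₁ * Y.W₂) x.snd) := by
  have h := B.isBCLPair.adj.swap.mulLinearSymbol_mulLinearSymbol x.fst
  rw [adjoint_adjoint, adjoint_adjoint] at h
  rw [douglasDilation_V₁_apply, douglasDilation_V₂_apply, ← h, Y.comm]
  rfl

namespace UnitaryPart

lemma W₁_mul_W₂_apply (Y : UnitaryPart T R) (h : H) :
    (Y.W₁ * Y.W₂) (Y.incl (toClosureRange T.Q (T.adj.prod h))) =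
      Y.incl (toClosureRange T.Q h) := by
  have h1 : T.adj.prod h = adjoint T.T₂ (adjoint T.T₁ h) := DFunLike.congr_fun T.adj.comm h
  change Y.W₁ (Y.W₂ _) = _
  rw [h1, ← Y.W₂_extends, LinearIsometryEquiv.apply_symm_apply, ← Y.W₁_extends,
    LinearIsometryEquiv.apply_symm_apply]

/-- A closed subspace that contains the range of `Q` and is invariant under `W₁ W₂` is everything,
by minimality. -/
lemma eq_top_of_invariant (Y : UnitaryPart T R) {M : Submodule ℂ R} (hM : IsClosed (M : Set R))
    (hQ : ∀ h, Y.incl (toClosureRange T.Q h) ∈ M) (hW : ∀ x ∈ M, (Y.W₁ * Y.W₂) x ∈ M) :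
    M = ⊤ := by
  have hpow : ∀ (n : ℕ), ∀ x ∈ M, ((Y.W₁ * Y.W₂) ^ n) x ∈ M := by
    intro n x hx
    induction n with
    | zero => exact hx
    | succ n ih =>
      rw [pow_succ']
      exact hW _ ih
  -- Negative powers of `W₁ W₂` map `Q h` to `Q T^{*n} h`, which is already in the range of `Q`.
  -- Forward invariance therefore captures the whole two-sided orbit used in minimality.
  have hneg : ∀ (n : ℕ) (h : H), ((Y.W₁ * Y.W₂) ^ n) (Y.incl (toClosureRange T.Q
      ((T.adj.prod ^ n) h))) = Y.incl (toClosureRange T.Q h) := by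
    intro n h
    induction n with
    | zero => rfl
    | succ n ih =>
      rw [pow_succ]
      change ((Y.W₁ * Y.W₂) ^ n) ((Y.W₁ * Y.W₂) _) = _
      rw [add_comm n 1, pow_add_apply, pow_one, W₁_mul_W₂_apply, ih]
  have hgen : ∀ (n : ℤ) (h : H), ((Y.W₁ * Y.W₂) ^ n) (Y.incl (toClosureRange T.Q h)) ∈ M := by
    intro n h
    obtain ⟨n, rfl | rfl⟩ := n.eq_nat_or_neg
    · rw [zpow_natCast]
      exact hpow n _ (hQ h)
    · rw [zpow_neg, zpow_natCast]
      have h1 : ((Y.W₁ * Y.W₂) ^ n)⁻¹ (Y.incl (toClosureRange T.Q h)) =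
          Y.incl (toClosureRange T.Q ((T.adj.prod ^ n) h)) := by
        rw [← hneg n h]
        exact ((Y.W₁ * Y.W₂) ^ n).symm_apply_apply _
      rw [h1]
      exact hQ _
  rw [eq_top_iff, ← Y.minimal]
  refine Submodule.topologicalClosure_minimal _ (Submodule.span_le.2 ?_) hM
  rintro _ ⟨n, y, rfl⟩
  exact (denseRange_toClosureRange T.Q).induction_on
    (p := fun y => ((Y.W₁ * Y.W₂) ^ n) (Y.incl y) ∈ M) y
    (hM.preimage (((Y.W₁ * Y.W₂) ^ n).continuous.comp Y.incl.continuous)) (hgen n)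

end UnitaryPart

/-- If `Γ` is surjective, then the Douglas-type dilation is a minimal isometric lift. -/
lemma isMinimalIsometricLift_douglasDilation (B : AndoTuple T.adj E) (Y : UnitaryPart T R)
    (hB : Function.Surjective B.Λ) : IsMinimalIsometricLift T (douglasDilation B Y) where
  norm_V₁ x := by
    have h := B.isBCLPair.adj.norm_mulLinearSymbol x.fst
    rw [adjoint_adjoint] at h
    refine (pow_left_inj₀ (norm_nonneg _) (norm_nonneg _) two_ne_zero).1 ?_
    rw [douglasDilation_V₁_apply, WithLp.prod_norm_sq_eq_of_L2, WithLp.prod_norm_sq_eq_of_L2 x]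
    change ‖mulLinearSymbol _ _ _‖ ^ 2 + ‖Y.W₁ x.snd‖ ^ 2 = _
    rw [h, LinearIsometryEquiv.norm_map]
  norm_V₂ x := by
    have h := B.isBCLPair.adj.swap.norm_mulLinearSymbol x.fst
    rw [adjoint_adjoint] at h
    refine (pow_left_inj₀ (norm_nonneg _) (norm_nonneg _) two_ne_zero).1 ?_
    rw [douglasDilation_V₂_apply, WithLp.prod_norm_sq_eq_of_L2, WithLp.prod_norm_sq_eq_of_L2 x]
    change ‖mulLinearSymbol _ _ _‖ ^ 2 + ‖Y.W₂ x.snd‖ ^ 2 = _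
    rw [h, LinearIsometryEquiv.norm_map]
  norm_Pi h := by
    refine (pow_left_inj₀ (norm_nonneg _) (norm_nonneg _) two_ne_zero).1 ?_
    rw [douglasDilation_Pi_apply, WithLp.prod_norm_sq_eq_of_L2, ← norm_sq_observability_add B h]
    change _ + ‖Y.incl _‖ ^ 2 = _
    rw [LinearIsometry.norm_map]
    rfl
  comm x := by rw [douglasDilation_V₁_V₂_apply, douglasDilation_V₂_V₁_apply]
  inner_V₁ h x := by
    rw [douglasDilation_V₁_apply, douglasDilation_Pi_apply, douglasDilation_Pi_apply,
      WithLp.prod_inner_apply, WithLp.prod_inner_apply]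
    refine congrArg₂ (· + ·) (inner_mulLinearSymbol (fun n => ?_) x.fst) ?_
    · rw [observability_apply, observability_apply, observability_apply, adjoint_adjoint,
        add_comm n 1, pow_add_apply, pow_one, B.E₁_auxVec_add]
      exact congrArg _ (T.adj.prod_pow_T₁_apply n h)
    · change inner ℂ (Y.incl _) (Y.W₁ x.snd) = inner ℂ (Y.incl _) x.snd
      rw [← Y.W₁_extends, ← LinearIsometryEquiv.inner_map_map Y.W₁ (Y.W₁.symm _),
        LinearIsometryEquiv.apply_symm_apply]
  inner_V₂ h x := by
    rw [douglasDilation_V₂_apply, douglasDilation_Pi_apply, douglasDilation_Pi_apply,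
      WithLp.prod_inner_apply, WithLp.prod_inner_apply]
    refine congrArg₂ (· + ·) (inner_mulLinearSymbol (fun n => ?_) x.fst) ?_
    · rw [observability_apply, observability_apply, observability_apply, adjoint_adjoint,
        add_comm n 1, pow_add_apply, pow_one, B.E₂_auxVec_add]
      exact congrArg _ (T.adj.prod_pow_T₂_apply n h)
    · change inner ℂ (Y.incl _) (Y.W₂ x.snd) = inner ℂ (Y.incl _) x.snd
      rw [← Y.W₂_extends, ← LinearIsometryEquiv.inner_map_map Y.W₂ (Y.W₂.symm _),
        LinearIsometryEquiv.apply_symm_apply]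
  minimal M hM hPi hV := by
    let i : HardySpace (AuxSpace T.adj E) →ₗᵢ[ℂ] WithLp 2 (HardySpace (AuxSpace T.adj E) × R) :=
      { toFun := fun f => WithLp.toLp 2 (f, 0)
        map_add' := fun x y => congrArg (WithLp.toLp 2) (Prod.ext (by simp) (by simp))
        map_smul' := fun c x => congrArg (WithLp.toLp 2) (Prod.ext (by simp) (by simp))
        norm_map' := fun f => WithLp.norm_toLp_fst 2 _ _ f }
    let j : R →ₗᵢ[ℂ] WithLp 2 (HardySpace (AuxSpace T.adj E) × R) :=
      { toFun := fun f => WithLp.toLp 2 (0, f)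
        map_add' := fun x y => congrArg (WithLp.toLp 2) (Prod.ext (by simp) (by simp))
        map_smul' := fun c x => congrArg (WithLp.toLp 2) (Prod.ext (by simp) (by simp))
        norm_map' := fun f => WithLp.norm_toLp_snd 2 _ _ f }
    have hc : ∀ v, i (constantFun _ v) ∈ M := by
      intro v
      obtain ⟨d, rfl⟩ := hB v
      refine (denseRange_toClosureRange (defect T.adj.prod)).induction_on
        (p := fun d => i (constantFun _ (B.Λ d)) ∈ M) d
        (hM.preimage (i.continuous.comp ((constantFun _).continuous.comp B.Λ.continuous)))
        fun h => ?_
      -- `Π h - V₁ V₂ Π T^* h = Γ D_{T^*} h ⊕ 0`: the shift removes all higher coefficients, and `W₁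
      -- W₂ Q T^* h = Q h` removes the unitary part.
      have h1 := M.sub_mem (hPi h) (hV _ (hPi (T.adj.prod h)))
      rw [douglasDilation_V₁_V₂_apply, douglasDilation_Pi_apply, observability_eq] at h1
      change i (constantFun _ (B.Λ (toDefect T.adj.prod h))) ∈ M
      rw [B.Λ_toDefect]
      convert h1 using 1
      refine congrArg (WithLp.toLp 2) (Prod.ext (add_sub_cancel_right _ _).symm ?_)
      exact (sub_eq_zero.2 (Y.W₁_mul_W₂_apply h).symm).symm
    have hi : ∀ f, i f ∈ M := by
      have htop : M.comap i.toLinearMap = ⊤ :=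
        HardySpace.eq_top_of_shift_invariant (hM.preimage i.continuous) hc fun f hf => by
          have h1 := hV _ hf
          rw [douglasDilation_V₁_V₂_apply] at h1
          change i (shift f) ∈ M
          convert h1 using 1
          exact congrArg (WithLp.toLp 2) (Prod.ext rfl (map_zero _).symm)
      exact fun f => (htop ▸ Submodule.mem_top : f ∈ M.comap i.toLinearMap)
    have hj : ∀ r, j r ∈ M := by
      have htop : M.comap j.toLinearMap = ⊤ := by
        refine Y.eq_top_of_invariant (hM.preimage j.continuous) (fun h => ?_) fun r hr => ?_
        · change j _ ∈ M
          -- Once the Hardy summand lies in `M`, subtracting the observability function from `Π h`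
          -- isolates `0 ⊕ Q h`.
          convert M.sub_mem (hPi h) (hi (observability B h)) using 1
          exact congrArg (WithLp.toLp 2) (Prod.ext (sub_self _).symm (sub_zero _).symm)
        · have h1 := hV _ hr
          rw [douglasDilation_V₁_V₂_apply] at h1
          change j _ ∈ M
          convert h1 using 1
          exact congrArg (WithLp.toLp 2) (Prod.ext (map_zero _).symm rfl)
      exact fun f => (htop ▸ Submodule.mem_top : f ∈ M.comap j.toLinearMap)
    refine eq_top_iff.2 fun x _ => ?_
    convert M.add_mem (hi x.fst) (hj x.snd) using 1
    exact congrArg (WithLp.toLp 2) (Prod.ext (add_zero _).symm (zero_add _).symm)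

end

/-! ### Andô tuples of regular factorizations -/

section

variable {H : Type*} [NormedAddCommGroup H] [InnerProductSpace ℂ H] [CompleteSpace H]
  (T : CommutingContractions H) (E : Type*) [NormedAddCommGroup E] [InnerProductSpace ℂ E]
  [CompleteSpace E]

/-- The embedding of `𝒟_{T₁} ⊕ 𝒟_{T₂}` into `ℱ`. -/
def auxEmbedding : WithLp 2 (defectSpace T.T₁ × defectSpace T.T₂) →ₗᵢ[ℂ] AuxSpace T E where
  toFun x := WithLp.toLp 2 (x.fst, WithLp.toLp 2 (x.snd, 0))
  map_add' x y := congrArg (WithLp.toLp 2) (Prod.ext (by simp)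
    (congrArg (WithLp.toLp 2) (Prod.ext (by simp) (by simp))))
  map_smul' c x := congrArg (WithLp.toLp 2) (Prod.ext (by simp)
    (congrArg (WithLp.toLp 2) (Prod.ext (by simp) (by simp))))
  norm_map' x := by
    refine (pow_left_inj₀ (norm_nonneg _) (norm_nonneg _) two_ne_zero).1 ?_
    rw [WithLp.prod_norm_sq_eq_of_L2 x, WithLp.prod_norm_sq_eq_of_L2]
    change ‖x.fst‖ ^ 2 + ‖(WithLp.toLp 2 (x.snd, (0 : E)))‖ ^ 2 = _
    rw [WithLp.norm_toLp_fst]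

lemma auxEmbedding_surjective [Subsingleton E] : Function.Surjective (auxEmbedding T E) :=
  fun x => ⟨WithLp.toLp 2 (x.fst, x.snd.fst), congrArg (WithLp.toLp 2) (Prod.ext rfl
    (congrArg (WithLp.toLp 2) (Prod.ext rfl (Subsingleton.elim _ _))))⟩

variable {T E}

/-- If both orders of the factorization are regular, then there is a unitary on
`𝒟_{T₁} ⊕ 𝒟_{T₂}` with the property required of the unitary in an Andô tuple. -/
lemma exists_unitary_of_isRegularFactorization (h₁₂ : IsRegularFactorization T.T₁ T.T₂)
    (h₂₁ : IsRegularFactorization T.T₂ T.T₁) :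
    ∃ U : WithLp 2 (defectSpace T.T₁ × defectSpace T.T₂) ≃ₗᵢ[ℂ]
        WithLp 2 (defectSpace T.T₁ × defectSpace T.T₂),
      ∀ h : H, U (WithLp.toLp 2 (toDefect T.T₁ (T.T₂ h), toDefect T.T₂ h)) =
        WithLp.toLp 2 (toDefect T.T₁ h, toDefect T.T₂ (T.T₁ h)) := by
  let e₁ : H →ₗ[ℂ] WithLp 2 (defectSpace T.T₁ × defectSpace T.T₂) :=
    { toFun := fun h => WithLp.toLp 2 (toDefect T.T₁ (T.T₂ h), toDefect T.T₂ h)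
      map_add' := fun x y => congrArg (WithLp.toLp 2) (Prod.ext (by simp) (by simp))
      map_smul' := fun c x => congrArg (WithLp.toLp 2) (Prod.ext (by simp) (by simp)) }
  let e₂ : H →ₗ[ℂ] WithLp 2 (defectSpace T.T₁ × defectSpace T.T₂) :=
    { toFun := fun h => WithLp.toLp 2 (toDefect T.T₁ h, toDefect T.T₂ (T.T₁ h))
      map_add' := fun x y => congrArg (WithLp.toLp 2) (Prod.ext (by simp) (by simp))
      map_smul' := fun c x => congrArg (WithLp.toLp 2) (Prod.ext (by simp) (by simp)) }
  have hd₂ : DenseRange e₂ := by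
    let s : WithLp 2 (defectSpace T.T₂ × defectSpace T.T₁) →
        WithLp 2 (defectSpace T.T₁ × defectSpace T.T₂) := fun x => WithLp.toLp 2 (x.snd, x.fst)
    have hs : Function.Surjective s := fun x => ⟨WithLp.toLp 2 (x.snd, x.fst), rfl⟩
    have hc : Continuous s := by fun_prop
    exact hs.denseRange.comp h₂₁ hc
  -- Both squared norms telescope to `‖h‖² - ‖T h‖²`, through the two orders of the product.
  have hn : ∀ h, ‖e₂ h‖ = ‖e₁ h‖ := fun h => by
    refine (pow_left_inj₀ (norm_nonneg _) (norm_nonneg _) two_ne_zero).1 ?_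
    rw [WithLp.prod_norm_sq_eq_of_L2, WithLp.prod_norm_sq_eq_of_L2]
    change ‖toDefect T.T₁ h‖ ^ 2 + ‖toDefect T.T₂ (T.T₁ h)‖ ^ 2 =
      ‖toDefect T.T₁ (T.T₂ h)‖ ^ 2 + ‖toDefect T.T₂ h‖ ^ 2
    have hc : T.T₁ (T.T₂ h) = T.T₂ (T.T₁ h) := DFunLike.congr_fun T.comm h
    simp only [norm_sq_toDefect _ T.norm_T₁, norm_sq_toDefect _ T.norm_T₂, hc]
    ring
  exact ⟨(LinearEquiv.refl ℂ H).extendOfIsometry e₁ e₂ h₁₂ hd₂ hn,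
    LinearEquiv.extendOfIsometry_eq (LinearEquiv.refl ℂ H) e₁ e₂ h₁₂ hd₂ hn⟩

/-- If both orders of the factorization are regular, then there is an Andô tuple without auxiliary
summand. -/
lemma nonempty_andoTuple (h₁₂ : IsRegularFactorization T.T₁ T.T₂)
    (h₂₁ : IsRegularFactorization T.T₂ T.T₁) : Nonempty (AndoTuple T PUnit.{1}) := by
  obtain ⟨U, hU⟩ := exists_unitary_of_isRegularFactorization h₁₂ h₂₁
  let j := LinearIsometryEquiv.ofSurjective (auxEmbedding T PUnit.{1})
    (auxEmbedding_surjective T PUnit.{1})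
  have hj : ∀ u v, j (WithLp.toLp 2 (u, v)) = WithLp.toLp 2 (u, WithLp.toLp 2 (v, 0)) :=
    fun _ _ => rfl
  refine ⟨⟨j.symm.trans (U.trans j), fun h => ?_, fun h => (not_nontrivial PUnit h).elim⟩⟩
  rw [← hj, ← hj, ← hU]
  simp only [LinearIsometryEquiv.trans_apply, LinearIsometryEquiv.symm_apply_apply]

namespace AndoTuple

lemma isRegularFactorization_of_surjective (A : AndoTuple T E) (hA : Function.Surjective A.Λ) :
    IsRegularFactorization T.T₁ T.T₂ := by
  have h1 : DenseRange (A.Λ ∘ toDefect T.prod) :=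
    hA.denseRange.comp (denseRange_toClosureRange _) A.Λ.continuous
  have h2 : A.Λ ∘ toDefect T.prod = auxEmbedding T E ∘ fun h =>
      WithLp.toLp 2 (toDefect T.T₁ (T.T₂ h), toDefect T.T₂ h) :=
    funext fun h => A.Λ_toDefect h
  rw [h2] at h1
  intro z
  -- An isometry induces the topology of its domain, so density of the image in `ℱ` pulls back
  -- without first showing `E = 0`.
  rw [(auxEmbedding T E).isometry.isUniformInducing.isInducing.closure_eq_preimage_closure_image,
    ← Set.range_comp]
  exact h1 (auxEmbedding T E z)

lemma surjective_of_isRegularFactorization (A : AndoTuple T E)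
    (h₁₂ : IsRegularFactorization T.T₁ T.T₂) (h₂₁ : IsRegularFactorization T.T₂ T.T₁) :
    Function.Surjective A.Λ := by
  -- Regularity of both orders provides a unitary on `𝒟_{T₁} ⊕ 𝒟_{T₂}`, so the rule for adding `E`
  -- forbids a nonzero one.
  have hE : Subsingleton E := not_nontrivial_iff_subsingleton.1 fun h =>
    A.only_if_needed h (exists_unitary_of_isRegularFactorization h₁₂ h₂₁)
  have h1 := (auxEmbedding_surjective T E).denseRange.comp h₁₂ (auxEmbedding T E).continuous
  have h2 : DenseRange A.Λ := by
    refine Dense.mono ?_ h1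
    rintro _ ⟨h, rfl⟩
    exact ⟨toDefect T.prod h, A.Λ_toDefect h⟩
  -- An isometry from a complete space has closed range, so dense range means surjective.
  rw [← Set.range_eq_univ, ← A.Λ.isometry.isClosedEmbedding.isClosed_range.closure_eq]
  exact h2.closure_range

end AndoTuple

end

end

end AndoDilation

theorem mainTheorem9 {H : Type u} [NormedAddCommGroup H] [InnerProductSpace ℂ H]
    [CompleteSpace H] (T : AndoDilation.CommutingContractions H) :
    -- The unitary part of the Douglas-type dilation exists, and if both factorizations are regular,
    -- then Andô tuples exist without any auxiliary summand.
    (∃ (R : Type u) (_ : NormedAddCommGroup R) (_ : InnerProductSpace ℂ R) (_ : CompleteSpace R),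
      Nonempty (AndoDilation.UnitaryPart T R)) ∧
    (AndoDilation.IsRegularFactorization T.T₁ T.T₂ ∧
        AndoDilation.IsRegularFactorization (ContinuousLinearMap.adjoint T.T₁)
          (ContinuousLinearMap.adjoint T.T₂) →
      Nonempty (AndoDilation.AndoTuple T PUnit.{1}) ∧
        Nonempty (AndoDilation.AndoTuple T.adj PUnit.{1})) ∧
    -- For all choices made in the two constructions:
    ∀ {E : Type v₁} [NormedAddCommGroup E] [InnerProductSpace ℂ E] [CompleteSpace E]
      {E' : Type v₂} [NormedAddCommGroup E'] [InnerProductSpace ℂ E'] [CompleteSpace E']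
      {R : Type v₃} [NormedAddCommGroup R] [InnerProductSpace ℂ R] [CompleteSpace R]
      (A : AndoDilation.AndoTuple T E) (B : AndoDilation.AndoTuple T.adj E')
      (Y : AndoDilation.UnitaryPart T R),
      ((Function.Surjective A.Λ ∧ Function.Surjective B.Λ) ↔
        (AndoDilation.IsRegularFactorization T.T₁ T.T₂ ∧
          AndoDilation.IsRegularFactorization (ContinuousLinearMap.adjoint T.T₁)
            (ContinuousLinearMap.adjoint T.T₂))) ∧
      (Function.Surjective A.Λ ∧ Function.Surjective B.Λ →
        (AndoDilation.schafferDilation A).UnitarilyEquivalent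
          (AndoDilation.douglasDilation B Y)) ∧
      (AndoDilation.IsRegularFactorization T.T₁ T.T₂ ∧
          AndoDilation.IsRegularFactorization (ContinuousLinearMap.adjoint T.T₁)
            (ContinuousLinearMap.adjoint T.T₂) →
        (AndoDilation.schafferDilation A).UnitarilyEquivalent
          (AndoDilation.douglasDilation B Y)) := by
  have e₁ := AndoDilation.isRegularFactorization_adjoint_iff T.norm_T₁ T.norm_T₂
  have e₂ := AndoDilation.isRegularFactorization_adjoint_iff T.norm_T₂ T.norm_T₁
  refine ⟨AndoDilation.exists_unitaryPart T, fun ⟨h, h'⟩ => ⟨AndoDilation.nonempty_andoTuple h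
    (e₁.1 h'), AndoDilation.nonempty_andoTuple (T := T.adj) h' (e₂.2 h)⟩, ?_⟩
  intro E _ _ _ E' _ _ _ R _ _ _ A B Y
  have h₁ : (Function.Surjective A.Λ ∧ Function.Surjective B.Λ) ↔
      (AndoDilation.IsRegularFactorization T.T₁ T.T₂ ∧
        AndoDilation.IsRegularFactorization (ContinuousLinearMap.adjoint T.T₁)
          (ContinuousLinearMap.adjoint T.T₂)) :=
    ⟨fun ⟨hA, hB⟩ => ⟨A.isRegularFactorization_of_surjective hA,
      B.isRegularFactorization_of_surjective hB⟩,
    fun ⟨h, h'⟩ => ⟨A.surjective_of_isRegularFactorization h (e₁.1 h'),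
      B.surjective_of_isRegularFactorization h' (e₂.2 h)⟩⟩
  have h₂ : Function.Surjective A.Λ ∧ Function.Surjective B.Λ →
      (AndoDilation.schafferDilation A).UnitarilyEquivalent (AndoDilation.douglasDilation B Y) :=
    fun ⟨hA, hB⟩ => (AndoDilation.isMinimalIsometricLift_schafferDilation A hA).unitarilyEquivalent
      (AndoDilation.isMinimalIsometricLift_douglasDilation B Y hB)
  exact ⟨h₁, h₂, fun h => h₂ (h₁.2 h)⟩
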